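/- Let $L,\Gamma\subset\mathbb R^n$ be full-rank lattices, and let $L^*=\{\xi\in\mathbb R^n:\langle\xi,p\rangle\in\mathbb Z\ \text{for all } p\in L\}$ be the dual lattice ($\mathbb R^n$ is identified with its dual by the standard inner product). Write $\hat t$ for the Fourier transform of a tempered distribution, normalised by $\hat\delta_p(\xi)=e^{-2\pi i\langle\xi,p\rangle}$. Let $t$ be a tempered distribution on $\mathbb R^n$ that is supported by the crystal $\Lambda=\bigcup_{i=1}^I(L+q_i)$ and whose Fourier transform $\hat t$ is supported by the crystal $\Sigma=\bigcup_{k=1}^K(\Gamma+\eta_k)$. (1) If $t\ne0$, then $\Gamma$ and $L^*$ are commensurable ($\Gamma\cap L^*$ has finite index in both $\Gamma$ and $L^*$). Moreover $\Sigma$ is contained in an $L^*$-crystal with shifts in $\Sigma$: there are finitely many $\eta'_1,\dots,\eta'_{K'}\in\Sigma$ with $\Sigma\subseteq\bigcup_{k}(L^*+\eta'_k)$. Thus the lattice $\Gamma$ may be replaced by $L^*$. (2) Whenever $\hat t$ is supported by an $L^*$-crystal $\bigcup_{k=1}^{K'}(L^*+\eta'_k)$ (by (1) such crystals exist; if $\Gamma=L^*$,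 then $\Sigma$ itself is one, with $\eta'_k=\eta_k$), there are differential operators with polynomial coefficients $P_{ik}(x,D)=\sum c^{ik}_{\alpha\beta}\,x^\alpha D^\beta$, $1\le i\le I$, $1\le k\le K'$, such that $t$ has the Poisson form $$t=\sum_{k=1}^{K'}\sum_{i=1}^{I}e^{2\pi i\langle\eta'_k,x\rangle}\,P_{ik}(x,D)\sum_{p\in L+q_i}\delta_p ,$$ and, for the same operators, $\hat t$ is given by the generalized Poisson summation formula $$\hat t=\frac1{\operatorname{covol}(L)}\sum_{k=1}^{K'}\sum_{i=1}^{I}\tau_{\eta'_k}\Big[P_{ik}\big(-(2\pi i)^{-1}D_\sigma,\,2\pi i\,\sigma\big)\Big(e^{-2\pi i\langle\sigma,q_i\rangle}\sum_{\lambda\in L^*}\delta_\lambda\Big)\Big].$$ Here $P_{ik}(-(2\pi i)^{-1}D_\sigma,2\pi i\sigma)=\sum c^{ik}_{\alpha\beta}\,(-(2\pi i)^{-1}D_\sigma)^\alpha(2\pi i\sigma)^\beta$ (multiplications applied first), $\tau_\eta$ is the shift with $\tau_\eta\delta_p=\delta_{p+\eta}$, and $\operatorname{covol}(L)=|\det g|$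 for $L=g\mathbb Z^n$. -/

import Mathlib

open scoped SchwartzMap FourierTransform LineDeriv

noncomputable section

/-- The Euclidean space `ℝⁿ`, identified with its dual by the standard inner product. -/
abbrev En (n : ℕ) : Type := EuclideanSpace ℝ (Fin n)

/-- Continuous linear endomorphisms of the space of tempered distributions on `ℝⁿ`. -/
abbrev DistOp (n : ℕ) : Type := 𝓢'(En n, ℂ) →L[ℂ] 𝓢'(En n, ℂ)

/-- The crystal `⋃ i, (L + q i)`. -/
def crystal {n I : ℕ} (L : Submodule ℤ (En n)) (q : Fin I → En n) : Set (En n) :=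
  ⋃ i, {x | ∃ p ∈ L, x = p + q i}

/-- The dual lattice `{ξ | ⟨ξ, p⟩ ∈ ℤ for all p ∈ L}`. -/
def dualLattice {n : ℕ} (L : Submodule ℤ (En n)) : Submodule ℤ (En n) :=
  LinearMap.BilinForm.dualSubmodule (innerₗ (En n)) L

theorem mem_dualLattice {n : ℕ} {L : Submodule ℤ (En n)} {x : En n} :
    x ∈ dualLattice L ↔ ∀ p ∈ L, ∃ m : ℤ, (m : ℝ) = inner ℝ x p := by
  simp [dualLattice, LinearMap.BilinForm.mem_dualSubmodule, Submodule.mem_one]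

instance dualLattice_discreteTopology {n : ℕ} (L : Submodule ℤ (En n))
    [DiscreteTopology L] [IsZLattice ℝ L] : DiscreteTopology (dualLattice L) := by
  classical
  have hB : LinearMap.BilinForm.Nondegenerate (innerₗ (En n)) := by
    constructor
    · intro x hx
      exact inner_self_eq_zero.1 (hx x)
    · intro x hx
      exact inner_self_eq_zero.1 (hx x)
  have hd : dualLattice L = Submodule.span ℤ (Set.range
      (LinearMap.BilinForm.dualBasis (innerₗ (En n)) hB
        ((Module.Free.chooseBasis ℤ L).ofZLatticeBasis ℝ L))) := by
    rw [← LinearMap.BilinForm.dualSubmodule_span_of_basis,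
      Module.Basis.ofZLatticeBasis_span, dualLattice]
  rw [hd]
  infer_instance

theorem summable_one_add_norm_lattice {n : ℕ} (L : Submodule ℤ (En n)) [DiscreteTopology L]
    (q : En n) :
    Summable fun p : L ↦ ((1 + ‖(p : En n) + q‖) ^ (Module.finrank ℤ L + 1))⁻¹ := by
  have h := ZLattice.summable_norm_sub_inv_pow L (Module.finrank ℤ L + 1) (Nat.lt_succ_self _) (-q)
  refine h.of_norm_bounded_eventually ?_
  have hfin : Set.Finite {p : L | (p : En n) + q = 0} := by
    refine Set.Subsingleton.finite fun a ha b hb ↦ Subtype.ext ?_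
    exact add_right_cancel (ha.trans hb.symm)
  refine Filter.mem_of_superset hfin.compl_mem_cofinite fun p hp ↦ ?_
  have hpos : 0 < ‖(p : En n) + q‖ := norm_pos_iff.2 hp
  simp only [Set.mem_ofPred_eq, sub_neg_eq_add, inv_pow]
  rw [Real.norm_of_nonneg (by positivity)]
  gcongr
  linarith

theorem norm_schwartz_le_lattice {n : ℕ} (k : ℕ) (φ : 𝓢(En n, ℂ)) (x : En n) :
    ‖φ x‖ ≤ (2 ^ k * (Finset.Iic (k, 0)).sup (schwartzSeminormFamily ℂ (En n) ℂ) φ) *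
      ((1 + ‖x‖) ^ k)⁻¹ := by
  have h := SchwartzMap.one_add_le_sup_seminorm_apply (𝕜 := ℂ) (m := (k, 0)) (k := k) (n := 0)
    le_rfl le_rfl φ x
  rw [norm_iteratedFDeriv_zero] at h
  rw [← div_eq_mul_inv, le_div_iff₀ (by positivity), mul_comm]
  exact h

theorem summable_schwartz_lattice {n : ℕ} (L : Submodule ℤ (En n)) [DiscreteTopology L]
    (q : En n) (φ : 𝓢(En n, ℂ)) : Summable fun p : L ↦ φ (p + q) :=
  ((summable_one_add_norm_lattice L q).mul_left _).of_norm_bounded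
    fun p ↦ norm_schwartz_le_lattice (Module.finrank ℤ L + 1) φ (p + q)

/-- The Dirac comb `∑ p ∈ L + q, δ_p` as a tempered distribution. -/
def comb {n : ℕ} (L : Submodule ℤ (En n)) [DiscreteTopology L] (q : En n) : 𝓢'(En n, ℂ) :=
  ContinuousLinearMap.toPointwiseConvergenceCLM _ _ _ _ <|
    SchwartzMap.mkCLMtoNormedSpace (σ := RingHom.id ℂ)
      (fun φ : 𝓢(En n, ℂ) ↦ ∑' p : L, φ (p + q))
      (fun φ ψ ↦ by
        simpa using (summable_schwartz_lattice L q φ).tsum_add (summable_schwartz_lattice L q ψ))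
      (fun a φ ↦ by
        simpa using tsum_mul_left)
      (by
        refine ⟨Finset.Iic (Module.finrank ℤ L + 1, 0), 2 ^ (Module.finrank ℤ L + 1) *
          ∑' p : L, ((1 + ‖(p : En n) + q‖) ^ (Module.finrank ℤ L + 1))⁻¹,
          mul_nonneg (by positivity) (tsum_nonneg fun p ↦ by positivity), fun φ ↦ ?_⟩
        have h := tsum_of_norm_bounded
          ((summable_one_add_norm_lattice L q).mul_left _).hasSum
          (fun p ↦ norm_schwartz_le_lattice (Module.finrank ℤ L + 1) φ (p + q))
        refine h.trans (le_of_eq ?_)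
        rw [tsum_mul_left]
        ring)

theorem comb_apply {n : ℕ} (L : Submodule ℤ (En n)) [DiscreteTopology L] (q : En n)
    (φ : 𝓢(En n, ℂ)) : comb L q φ = ∑' p : L, φ (p + q) := rfl

/-- The operator of multiplication by the coordinate `x_i`. -/
def mulX {n : ℕ} (i : Fin n) : DistOp n :=
  TemperedDistribution.smulLeftCLM ℂ fun x : En n ↦ ((x i : ℝ) : ℂ)

/-- The partial derivative `∂_i`. -/
def partialD {n : ℕ} (i : Fin n) : DistOp n :=
  LineDeriv.lineDerivOpCLM ℂ 𝓢'(En n, ℂ) (EuclideanSpace.single i (1 : ℝ))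

/-- For a polynomial `P(x, D) = ∑ c_{αβ} x^α D^β` in `2n` variables (`Sum.inl i` stands for `x_i`,
`Sum.inr i` for `D_i`) and two tuples of operators `X`, `Y`, the operator
`P(X, Y) = ∑ c_{αβ} X^α Y^β`, in which the powers of `Y` are applied first. -/
def opSubst {n : ℕ} (P : MvPolynomial (Fin n ⊕ Fin n) ℂ) (X Y : Fin n → DistOp n) : DistOp n :=
  ∑ m ∈ P.support, P.coeff m •
    ((List.ofFn fun i ↦ X i ^ m (Sum.inl i)).prod * (List.ofFn fun i ↦ Y i ^ m (Sum.inr i)).prod)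

/-- The differential operator `P(x, D)` with polynomial coefficients. -/
def polyDiffOp {n : ℕ} (P : MvPolynomial (Fin n ⊕ Fin n) ℂ) : DistOp n :=
  opSubst P mulX partialD

/-- The operator `P(-(2πi)⁻¹ D_σ, 2πi σ)`. -/
def fourierPolyDiffOp {n : ℕ} (P : MvPolynomial (Fin n ⊕ Fin n) ℂ) : DistOp n :=
  opSubst P (fun i ↦ (-(2 * Real.pi * Complex.I)⁻¹ : ℂ) • partialD i)
    (fun i ↦ (2 * Real.pi * Complex.I : ℂ) • mulX i)

/-- Multiplication by the character `exp(2πi⟨η, x⟩)`. -/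
def expMul {n : ℕ} (η : En n) : DistOp n :=
  TemperedDistribution.smulLeftCLM ℂ fun x : En n ↦
    Complex.exp (2 * Real.pi * Complex.I * ((inner ℝ η x : ℝ) : ℂ))

/-- The shift of a distribution by the vector `η`; it takes `δ_p` to `δ_{p + η}`. -/
def shiftBy {n : ℕ} (η : En n) : DistOp n :=
  PointwiseConvergenceCLM.precomp ℂ (SchwartzMap.compSubConstCLM ℂ (-η))

end

/-! Let `E_ξ` be multiplication by the character of `ξ` and `S_p` the shift by `p`; they satisfy the
Weyl relation `E_ξ S_p = ω S_p E_ξ` with `ω = exp(2πi⟨ξ,p⟩)` (`expMul_mul_shiftBy`). A tempered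
distribution has finite order, so a high enough power of a multiplier that vanishes on the support
of `t` annihilates `t`. Hence products of powers of `E_ξ - exp(2πi⟨ξ,q_i⟩)`, `ξ ∈ L*`, annihilate
`t`. The same fact for the Fourier transform of `t` gives products in the shifts by vectors of `Γ*`.
From here on both hypotheses are algebraic.

Commensurability: take `ξ ∈ L*` and `γ ∈ Γ*`. The nonzero vector `t` is annihilated by a polynomial
in `E_ξ` and by one in `S_γ`. If `ω` were not a root of unity, the powers of one operator would move
an eigenvector of the other through infinitely many distinct eigenvalues, which a polynomial
relation forbids (`exists_pow_eq_one_of_mul_eq_smul_mul`). So all `⟨ξ,γ⟩` are rational, and a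
multiple of `L*` lies in `Γ`.

Poisson form: for `Γ = L*` the operators `E_ξ`, `S_p` attached to dual bases of `L*` and `L`
commute, so `t` is a sum of joint generalised eigenvectors (`mem_span_simultaneous`). The
annihilating products force the eigenvalues of a nonzero summand to come from one `q_i` and one
`η_k` (`exists_forall_eigenvalue_eq`). After demodulation by `η_k`, the relations `T X = (X + c) T`,
with `X` a linear form for shifts and a derivative for modulations, produce generalised eigenvectors
from genuine ones (`mem_of_genEigenvector`). The genuine ones are multiples of the Dirac comb of `L
+ q_i` (`exists_eq_smul_comb`). That uniqueness also yields Poisson summation, from which the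
formula for the Fourier transform follows term by term. -/

/-! ### Plane waves as multipliers of tempered growth. -/

/-- The plane wave `x ↦ exp(2πi⟨η, x⟩)`. -/
noncomputable def planeWave {n : ℕ} (η x : En n) : ℂ :=
  Complex.exp (2 * Real.pi * Complex.I * ((inner ℝ η x : ℝ) : ℂ))

theorem hasTemperateGrowth_cexp_mul_I (r : ℝ) :
    (fun s : ℝ ↦ Complex.exp (r * Complex.I * (s : ℂ))).HasTemperateGrowth := by
  have hs : ContDiff ℝ ⊤ (fun s : ℝ ↦ Complex.exp (r * Complex.I * (s : ℂ))) :=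
    (contDiff_const.mul Complex.ofRealCLM.contDiff).cexp
  have hd : ∀ k : ℕ, iteratedDeriv k (fun s : ℝ ↦ Complex.exp (r * Complex.I * (s : ℂ))) =
      fun s : ℝ ↦ (r * Complex.I) ^ k * Complex.exp (r * Complex.I * (s : ℂ)) := by
    intro k
    induction k with
    | zero => simp
    | succ k ih =>
      rw [iteratedDeriv_succ, ih]
      funext s
      have h1 : HasDerivAt (fun s : ℝ ↦ (s : ℂ)) 1 s := Complex.ofRealCLM.hasDerivAt
      have h2 := ((h1.const_mul (r * Complex.I)).cexp).const_mul ((r * Complex.I) ^ k)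
      rw [h2.deriv]
      ring
  refine ⟨hs.of_le (by simp), fun k ↦ ⟨0, |r| ^ k, fun x ↦ ?_⟩⟩
  rw [norm_iteratedFDeriv_eq_norm_iteratedDeriv, hd]
  simp only [norm_mul, norm_pow, Complex.norm_I, Complex.norm_real, pow_zero, mul_one]
  rw [show (r : ℂ) * Complex.I * (x : ℂ) = ((r * x : ℝ) : ℂ) * Complex.I by push_cast; ring,
    Complex.norm_exp_ofReal_mul_I]
  simp

theorem hasTemperateGrowth_planeWave {n : ℕ} (η : En n) : (planeWave η).HasTemperateGrowth := by
  have h := (hasTemperateGrowth_cexp_mul_I (2 * Real.pi)).comp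
    (Function.hasTemperateGrowth_inner_right η)
  have he : planeWave η = (fun s : ℝ ↦ Complex.exp ((2 * Real.pi : ℝ) * Complex.I * (s : ℂ))) ∘
      fun x ↦ inner ℝ η x := by
    funext x
    simp [planeWave]
  rw [he]
  exact h

/-! ### Finite order of tempered distributions. -/

section bounds

variable {E : Type*} [NormedAddCommGroup E] [NormedSpace ℝ E]

/-- A tempered distribution has finite order: it is controlled by finitely many derivatives of a
multiplier. -/
theorem TemperedDistribution.exists_norm_smul_le (T : 𝓢'(E, ℂ)) :
    ∃ M : ℕ, ∀ (φ : 𝓢(E, ℂ)) (k : ℕ), ∃ C : ℝ, ∀ (f : E → ℂ) (A : ℝ), f.HasTemperateGrowth →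
      0 ≤ A → (∀ i ≤ M, ∀ x, ‖iteratedFDeriv ℝ i f x‖ ≤ A * (1 + ‖x‖) ^ k) →
      ‖T (SchwartzMap.smulLeftCLM ℂ f φ)‖ ≤ C * A := by
  obtain ⟨s, C, -, hC⟩ := Seminorm.bound_of_continuous (schwartz_withSeminorms ℂ E ℂ)
    ((normSeminorm ℂ ℂ).comp (T : 𝓢(E, ℂ) →L[ℂ] ℂ).toLinearMap)
    (continuous_norm.comp (T : 𝓢(E, ℂ) →L[ℂ] ℂ).continuous)
  -- `M` is the largest number of derivatives in the seminorms that bound `T`. It is fixed before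
  -- `φ` and the growth exponent `k`, which only affect the constant because `φ` decays rapidly.
  refine ⟨s.sup Prod.snd, fun φ k ↦ ?_⟩
  have key : ∀ m : ℕ × ℕ, ∃ B : ℝ, 0 ≤ B ∧ ∀ (f : E → ℂ) (A : ℝ), f.HasTemperateGrowth →
      0 ≤ A → (∀ i ≤ m.2, ∀ x, ‖iteratedFDeriv ℝ i f x‖ ≤ A * (1 + ‖x‖) ^ k) →
      schwartzSeminormFamily ℂ E ℂ m (SchwartzMap.smulLeftCLM ℂ f φ) ≤ B * A := by
    rintro ⟨l, m⟩
    set S : ℝ := 2 ^ (k + l) * (Finset.Iic (k + l, m)).sup (schwartzSeminormFamily ℂ E ℂ) φ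
    have hS : 0 ≤ S := by positivity
    have hφ : ∀ j ≤ m, ∀ x, (1 + ‖x‖) ^ (k + l) * ‖iteratedFDeriv ℝ j φ x‖ ≤ S := fun j hj x ↦
      SchwartzMap.one_add_le_sup_seminorm_apply (𝕜 := ℂ) (m := (k + l, m)) le_rfl hj φ x
    refine ⟨2 ^ m * S, by positivity, fun f A hf hA hfA ↦ ?_⟩
    refine SchwartzMap.seminorm_le_bound ℂ l m _ (by positivity) fun x ↦ ?_
    rw [SchwartzMap.smulLeftCLM_apply hf]
    have h1 := norm_iteratedFDeriv_mul_le (𝕜 := ℝ) (N := (⊤ : ℕ∞)) hf.1 (φ.smooth ⊤) x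
      (n := m) (mod_cast le_top)
    have h2 : ∀ i ∈ Finset.range (m + 1), ‖x‖ ^ l * ((m.choose i : ℝ) *
        ‖iteratedFDeriv ℝ i f x‖ * ‖iteratedFDeriv ℝ (m - i) φ x‖) ≤ m.choose i * (S * A) := by
      intro i hi
      have hi' : i ≤ m := Nat.lt_succ_iff.1 (Finset.mem_range.1 hi)
      calc ‖x‖ ^ l * ((m.choose i : ℝ) *
        ‖iteratedFDeriv ℝ i f x‖ * ‖iteratedFDeriv ℝ (m - i) φ x‖)
          ≤ (1 + ‖x‖) ^ l * ((m.choose i : ℝ) *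
        (A * (1 + ‖x‖) ^ k) * ‖iteratedFDeriv ℝ (m - i) φ x‖) := by
            gcongr
            · linarith
            · exact hfA i hi' x
        _ = m.choose i * (((1 + ‖x‖) ^ (k + l) * ‖iteratedFDeriv ℝ (m - i) φ x‖) * A) := by
            rw [pow_add]; ring
        _ ≤ _ := by
            gcongr
            exact hφ _ (Nat.sub_le _ _) x
    calc ‖x‖ ^ l * ‖iteratedFDeriv ℝ m (f • ⇑φ) x‖
        ≤ ‖x‖ ^ l * ∑ i ∈ Finset.range (m + 1), ((m.choose i : ℝ) *
        ‖iteratedFDeriv ℝ i f x‖ * ‖iteratedFDeriv ℝ (m - i) φ x‖) := by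
          gcongr
          exact h1
      _ ≤ ∑ i ∈ Finset.range (m + 1), m.choose i * (S * A) := by
          rw [Finset.mul_sum]
          exact Finset.sum_le_sum h2
      _ = 2 ^ m * S * A := by
          rw [← Finset.sum_mul, ← Nat.cast_sum, Nat.sum_range_choose]
          push_cast
          ring
  choose B hB0 hB using key
  refine ⟨C * ∑ m ∈ s, B m, fun f A hf hA hfA ↦ ?_⟩
  have h1 := hC (SchwartzMap.smulLeftCLM ℂ f φ)
  refine h1.trans ?_
  change (C : ℝ) * (s.sup (schwartzSeminormFamily ℂ E ℂ)) (SchwartzMap.smulLeftCLM ℂ f φ) ≤ _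
  rw [mul_assoc]
  gcongr
  rw [Finset.sum_mul]
  refine Seminorm.finset_sup_apply_le (Finset.sum_nonneg fun m _ ↦ mul_nonneg (hB0 m) hA)
    fun m hm ↦ ?_
  refine (hB m f A hf hA fun i hi ↦ hfA i (hi.trans (Finset.le_sup (f := Prod.snd) hm))).trans ?_
  exact Finset.single_le_sum (f := fun m ↦ B m * A) (fun m _ ↦ mul_nonneg (hB0 m) hA) hm

variable [FiniteDimensional ℝ E]

/-- Two tempered distributions that agree on compactly supported test functions are equal. -/
theorem TemperedDistribution.apply_eq_zero_of_compactSupport (T : 𝓢'(E, ℂ)) (φ : 𝓢(E, ℂ))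
    (h : ∀ χ : E → ℂ, HasCompactSupport χ → χ.HasTemperateGrowth →
      T (SchwartzMap.smulLeftCLM ℂ χ φ) = 0) : T φ = 0 := by
  obtain ⟨M, hM⟩ := T.exists_norm_smul_le
  -- Weight exponent 1 suffices: the tail `1 - χ(x/R)` vanishes for `‖x‖ ≤ R`, so it is `O(R⁻¹(1 +
  -- ‖x‖))`, and each of its derivatives carries a factor `R⁻¹`. Letting `R → ∞` gives the claim.
  obtain ⟨C, hC⟩ := hM φ 1
  let b : ContDiffBump (0 : E) := ⟨1, 2, one_pos, one_lt_two⟩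
  let χ : E → ℂ := fun x ↦ ((b x : ℝ) : ℂ)
  have hχs : ContDiff ℝ (⊤ : ℕ∞) χ := Complex.ofRealCLM.contDiff.comp b.contDiff
  have hχc : HasCompactSupport χ := b.hasCompactSupport.comp_left (g := Complex.ofReal) rfl
  have hχt : χ.HasTemperateGrowth := hχc.hasTemperateGrowth hχs
  let ψ : E → ℂ := fun x ↦ 1 - χ x
  have hψt : ψ.HasTemperateGrowth := (Function.HasTemperateGrowth.const 1).sub hχt
  have hψb : ∃ B : ℝ, 0 ≤ B ∧ ∀ i ≤ M, ∀ x, ‖iteratedFDeriv ℝ i ψ x‖ ≤ B := by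
    have : ∀ i, ∃ B : ℝ, 0 ≤ B ∧ ∀ x, ‖iteratedFDeriv ℝ i ψ x‖ ≤ B := by
      intro i
      have hc : Continuous (iteratedFDeriv ℝ i χ) :=
        hχs.continuous_iteratedFDeriv (mod_cast le_top)
      obtain ⟨B, hB⟩ := (hχc.iteratedFDeriv i).exists_bound_of_continuous hc
      refine ⟨1 + |B|, by positivity, fun x ↦ ?_⟩
      have : ψ = (fun _ ↦ (1 : ℂ)) - χ := rfl
      rw [this, iteratedFDeriv_sub_apply contDiffAt_const (hχs.of_le (mod_cast le_top)).contDiffAt]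
      refine (norm_sub_le _ _).trans ?_
      refine add_le_add ?_ ((hB x).trans (le_abs_self B))
      rcases Nat.eq_zero_or_pos i with rfl | hi
      · simp
      · rw [iteratedFDeriv_const_of_ne hi.ne']
        simp
    choose B hB0 hB using this
    refine ⟨∑ i ∈ Finset.range (M + 1), B i, Finset.sum_nonneg fun i _ ↦ hB0 i, fun i hi x ↦ ?_⟩
    exact (hB i x).trans (Finset.single_le_sum (f := B) (fun i _ ↦ hB0 i)
      (Finset.mem_range.2 (Nat.lt_succ_of_le hi)))
  obtain ⟨B, hB0, hB⟩ := hψb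
  have hest : ∀ R : ℝ, 1 ≤ R → ‖T φ‖ ≤ C * ((M.factorial * B) * R⁻¹) := by
    intro R hR
    have hR0 : 0 < R := by linarith
    let g : E → E := fun x ↦ R⁻¹ • x
    have hg : g.HasTemperateGrowth := (R⁻¹ • ContinuousLinearMap.id ℝ E).hasTemperateGrowth
    have hgd : ∀ x, ∀ i, 1 ≤ i → ‖iteratedFDeriv ℝ i g x‖ ≤ (R⁻¹) ^ i := by
      intro x i hi
      have hgl : fderiv ℝ g = fun _ ↦ (R⁻¹ • ContinuousLinearMap.id ℝ E) := by
        funext y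
        exact (R⁻¹ • ContinuousLinearMap.id ℝ E).fderiv
      rcases hi.eq_or_lt with rfl | hi
      · rw [norm_iteratedFDeriv_one, hgl, pow_one, norm_smul,
          Real.norm_of_nonneg (by positivity)]
        exact mul_le_of_le_one_right (by positivity) ContinuousLinearMap.norm_id_le
      · have : iteratedFDeriv ℝ i g x = 0 := by
          obtain ⟨j, rfl⟩ : ∃ j, i = j + 2 := ⟨i - 2, by omega⟩
          have := norm_iteratedFDeriv_fderiv (𝕜 := ℝ) (f := g) (x := x) (n := j + 1)
          rw [hgl, iteratedFDeriv_const_of_ne (Nat.succ_ne_zero j)] at this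
          rw [← norm_eq_zero, ← this]
          simp
        rw [this, norm_zero]
        positivity
    have h1 : T (SchwartzMap.smulLeftCLM ℂ (χ ∘ g) φ) = 0 := by
      refine h _ ?_ (hχt.comp hg)
      exact hχc.comp_homeomorph (Homeomorph.smulOfNeZero R⁻¹ (by positivity))
    have h2 : φ = SchwartzMap.smulLeftCLM ℂ (χ ∘ g) φ + SchwartzMap.smulLeftCLM ℂ (ψ ∘ g) φ := by
      ext x
      rw [add_apply, SchwartzMap.smulLeftCLM_apply_apply (hχt.comp hg),
        SchwartzMap.smulLeftCLM_apply_apply (hψt.comp hg)]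
      simp only [ψ, Function.comp, smul_eq_mul]
      ring
    have h3 : ‖T (SchwartzMap.smulLeftCLM ℂ (ψ ∘ g) φ)‖ ≤ C * ((M.factorial * B) * R⁻¹) := by
      refine hC _ _ (hψt.comp hg) (by positivity) fun i hi x ↦ ?_
      rw [pow_one]
      rcases Nat.eq_zero_or_pos i with rfl | hi0
      · rw [norm_iteratedFDeriv_zero]
        by_cases hx : ‖x‖ ≤ R
        · have : χ (g x) = 1 := by
            have : b (g x) = 1 := by
              apply b.one_of_mem_closedBall
              simp only [Metric.mem_closedBall, dist_zero_right, g, norm_smul, norm_inv,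
                Real.norm_of_nonneg hR0.le, b]
              rw [inv_mul_le_iff₀ hR0]
              linarith
            simp [χ, this]
          simp only [Function.comp, ψ, this, sub_self, norm_zero]
          positivity
        · push Not at hx
          have h4 := hB 0 (Nat.zero_le _) (g x)
          rw [norm_iteratedFDeriv_zero] at h4
          refine h4.trans ?_
          have : 1 ≤ R⁻¹ * (1 + ‖x‖) := by
            rw [← div_eq_inv_mul, le_div_iff₀ hR0]
            linarith
          have hf : (1 : ℝ) ≤ M.factorial := mod_cast Nat.one_le_iff_ne_zero.2 M.factorial_ne_zero
          calc B = 1 * B * 1 := by ring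
            _ ≤ M.factorial * B * (R⁻¹ * (1 + ‖x‖)) := by gcongr
            _ = _ := by ring
      · have h4 := norm_iteratedFDeriv_comp_le (𝕜 := ℝ) (N := (⊤ : ℕ∞)) hψt.1 hg.1 (n := i)
          (mod_cast le_top) x (C := B) (D := R⁻¹) (fun j hj ↦ hB j (hj.trans hi) _)
          (fun j hj _ ↦ hgd x j hj)
        refine h4.trans ?_
        have h5 : (R⁻¹) ^ i ≤ R⁻¹ :=
          pow_le_of_le_one (by positivity) (inv_le_one_of_one_le₀ hR) hi0.ne'
        calc (i.factorial : ℝ) * B * R⁻¹ ^ i ≤ M.factorial * B * R⁻¹ * 1 := by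
              rw [mul_one]
              gcongr
          _ ≤ _ := by
              gcongr
              linarith [norm_nonneg x]
    calc ‖T φ‖ = ‖T (SchwartzMap.smulLeftCLM ℂ (ψ ∘ g) φ)‖ := by
          conv_lhs => rw [h2, map_add, h1, zero_add]
      _ ≤ _ := h3
  have hlim : Filter.Tendsto (fun R : ℝ ↦ C * ((M.factorial * B) * R⁻¹)) Filter.atTop (nhds 0) := by
    simpa using (tendsto_inv_atTop_zero.const_mul (M.factorial * B)).const_mul C
  exact norm_le_zero_iff.1 (ge_of_tendsto hlim (Filter.eventually_atTop.2 ⟨1, hest⟩))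

end bounds

/-! ### Supports, and multipliers that vanish on them. -/

section support

variable {E : Type*} [NormedAddCommGroup E] [NormedSpace ℝ E] [FiniteDimensional ℝ E]

open Distribution Manifold in
/-- A tempered distribution vanishes on the complement of its support. -/
theorem TemperedDistribution.isVanishingOn_compl_dsupport (T : 𝓢'(E, ℂ)) :
    IsVanishingOn T (dsupport T)ᶜ := by
  intro φ hφ
  -- Vanishing near each point of the complement is only local information. The cutoff makes the
  -- support compact, so that finitely many such neighbourhoods and a subordinate partition of unity
  -- suffice.
  refine T.apply_eq_zero_of_compactSupport φ fun χ hχ hχt ↦ ?_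
  set φ' := SchwartzMap.smulLeftCLM ℂ χ φ with hφ'
  have hφ'a : ∀ x, φ' x = χ x * φ x := fun x ↦ by
    rw [hφ', SchwartzMap.smulLeftCLM_apply_apply hχt, smul_eq_mul]
  have hK : IsCompact (tsupport φ') := by
    have : (φ' : E → ℂ) = χ * φ := by
      funext x
      rw [hφ'a, Pi.mul_apply]
    rw [this]
    exact hχ.mul_right
  have hKs : tsupport φ' ⊆ (dsupport T)ᶜ :=
    (SchwartzMap.tsupport_smulLeftCLM_subset χ φ).trans
      (Set.inter_subset_left.trans hφ)
  have hex : ∀ x ∈ tsupport φ', ∃ U : Set E, IsVanishingOn T U ∧ IsOpen U ∧ x ∈ U := fun x hx ↦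
    (notMem_dsupport_iff x).1 (hKs hx)
  choose! U hUv hUo hUx using hex
  obtain ⟨t, htK, htU⟩ := hK.elim_nhds_subcover U fun x hx ↦ (hUo x hx).mem_nhds (hUx x hx)
  obtain ⟨f, hf⟩ := SmoothPartitionOfUnity.exists_isSubordinate 𝓘(ℝ, E) (isClosed_tsupport φ')
    (fun i : t ↦ U i) (fun i ↦ hUo i (htK i i.2)) (by
      intro x hx
      obtain ⟨i, hi, hxi⟩ := Set.mem_iUnion₂.1 (htU hx)
      exact Set.mem_iUnion.2 ⟨⟨i, hi⟩, hxi⟩)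
  let g : t → E → ℂ := fun i x ↦ ((f i x : ℝ) : ℂ) * χ x
  have hgt : ∀ i, (g i).HasTemperateGrowth := fun i ↦ by
    refine HasCompactSupport.hasTemperateGrowth (HasCompactSupport.mul_left hχ) ?_
    exact (Complex.ofRealCLM.contDiff.comp (f i).contMDiff.contDiff).mul hχt.1
  have hsum : φ' = ∑ i, SchwartzMap.smulLeftCLM ℂ (g i) φ := by
    ext x
    have h1 : (∑ i, SchwartzMap.smulLeftCLM ℂ (g i) φ) x = ∑ i, g i x * φ x := by
      rw [sum_apply]
      refine Finset.sum_congr rfl fun i _ ↦ ?_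
      rw [SchwartzMap.smulLeftCLM_apply_apply (hgt i), smul_eq_mul]
    have h2 : ∀ i, g i x * φ x = ((f i x : ℝ) : ℂ) * φ' x := fun i ↦ by
      rw [hφ'a]
      simp only [g]
      ring
    rw [h1, Finset.sum_congr rfl fun i _ ↦ h2 i, ← Finset.sum_mul]
    by_cases hx : x ∈ tsupport φ'
    · have := f.sum_eq_one hx
      rw [finsum_eq_sum_of_fintype] at this
      rw [← Complex.ofReal_sum, this]
      simp
    · rw [image_eq_zero_of_notMem_tsupport hx, mul_zero]
  rw [hsum, map_sum]
  refine Finset.sum_eq_zero fun i _ ↦ hUv i (htK i i.2) _ ?_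
  refine (SchwartzMap.tsupport_smulLeftCLM_subset (g i) φ).trans
    (Set.inter_subset_right.trans (subset_trans ?_ (hf i)))
  have : tsupport (fun x ↦ ((f i x : ℝ) : ℂ)) ⊆ tsupport (f i) :=
    closure_mono fun x hx h0 ↦ hx (by simp [h0])
  exact (tsupport_mul_subset_left (f := fun x ↦ ((f i x : ℝ) : ℂ)) (g := χ)).trans this

open Distribution in
/-- High powers of a function that vanishes on the support of a tempered distribution annihilate
the distribution; the exponent depends on the distribution only. -/
theorem TemperedDistribution.exists_smulLeftCLM_pow_eq_zero (T : 𝓢'(E, ℂ)) :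
    ∃ N : ℕ, ∀ g : E → ℂ, g.HasTemperateGrowth → (∀ x ∈ dsupport T, g x = 0) →
      smulLeftCLM ℂ (g ^ N) T = 0 := by
  obtain ⟨M, hM⟩ := T.exists_norm_smul_le
  -- One power more than the order: `g ^ (M + 1)` is split by the cutoff `ψ(R g)`. The part with `‖R
  -- g‖ ≥ 1` is supported away from `dsupport T`. The other part is `R ^ (-(M + 1)) Ψ(R g)`, and at
  -- most `M` derivatives cost at most `R ^ M`, which leaves a factor `R⁻¹`.
  refine ⟨M + 1, fun g hg hg0 ↦ ?_⟩
  ext φ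
  rw [smulLeftCLM_apply_apply, zero_apply]
  obtain ⟨k, D, hD0, hD⟩ := hg.norm_iteratedFDeriv_le_uniform M
  -- By the chain rule at most `M` derivatives of `g` are multiplied, each of growth `(1 + ‖x‖) ^
  -- k`.
  obtain ⟨C, hC⟩ := hM φ (k * M)
  let b : ContDiffBump (0 : ℂ) := ⟨1, 2, one_pos, one_lt_two⟩
  let ψ : ℂ → ℂ := fun z ↦ ((b z : ℝ) : ℂ)
  have hψs : ContDiff ℝ (⊤ : ℕ∞) ψ := Complex.ofRealCLM.contDiff.comp b.contDiff
  have hψc : HasCompactSupport ψ := b.hasCompactSupport.comp_left (g := Complex.ofReal) rfl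
  have hψt : ψ.HasTemperateGrowth := hψc.hasTemperateGrowth hψs
  let Ψ : ℂ → ℂ := fun z ↦ z ^ (M + 1) * ψ z
  have hΨs : ContDiff ℝ (⊤ : ℕ∞) Ψ := (contDiff_id.pow _).mul hψs
  have hΨc : HasCompactSupport Ψ := hψc.mul_left
  have hΨt : Ψ.HasTemperateGrowth := hΨc.hasTemperateGrowth hΨs
  obtain ⟨B, hB0, hB⟩ : ∃ B : ℝ, 0 ≤ B ∧ ∀ i ≤ M, ∀ x, ‖iteratedFDeriv ℝ i Ψ x‖ ≤ B := by
    have : ∀ i, ∃ B : ℝ, 0 ≤ B ∧ ∀ x, ‖iteratedFDeriv ℝ i Ψ x‖ ≤ B := by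
      intro i
      obtain ⟨B, hB⟩ := (hΨc.iteratedFDeriv i).exists_bound_of_continuous
        (hΨs.continuous_iteratedFDeriv (mod_cast le_top))
      exact ⟨B, (norm_nonneg _).trans (hB 0), hB⟩
    choose B hB0 hB using this
    refine ⟨∑ i ∈ Finset.range (M + 1), B i, Finset.sum_nonneg fun i _ ↦ hB0 i, fun i hi x ↦ ?_⟩
    exact (hB i x).trans (Finset.single_le_sum (f := B) (fun i _ ↦ hB0 i)
      (Finset.mem_range.2 (Nat.lt_succ_of_le hi)))
  set T0 := T (SchwartzMap.smulLeftCLM ℂ (g ^ (M + 1)) φ) with hT0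
  have hest : ∀ R : ℝ, 1 ≤ R → ‖T0‖ ≤ C * ((M.factorial * B * (D + 1) ^ M) * R⁻¹) := by
    intro R hR
    have hR0 : 0 < R := by linarith
    let gR : E → ℂ := fun x ↦ (R : ℂ) * g x
    have hgR : gR.HasTemperateGrowth := (Function.HasTemperateGrowth.const (R : ℂ)).mul hg
    have hgRd : ∀ x, ∀ i, 1 ≤ i → i ≤ M →
        ‖iteratedFDeriv ℝ i gR x‖ ≤ (R * (D + 1) * (1 + ‖x‖) ^ k) ^ i := by
      intro x i hi hiM
      have h1 : gR = R • g := by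
        funext y
        simp [gR]
      rw [h1, iteratedFDeriv_const_smul_apply (hg.1.of_le (mod_cast le_top)).contDiffAt,
        norm_smul, Real.norm_of_nonneg hR0.le]
      have h2 : 1 ≤ (1 + ‖x‖) ^ k := one_le_pow₀ (by linarith [norm_nonneg x])
      calc R * ‖iteratedFDeriv ℝ i g x‖ ≤ R * (D * (1 + ‖x‖) ^ k) := by
            gcongr
            exact hD i hiM x
        _ ≤ R * (D + 1) * (1 + ‖x‖) ^ k := by
            rw [mul_assoc]
            gcongr
            linarith
        _ ≤ _ := by
            refine le_self_pow₀ ?_ (by omega)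
            have : 1 ≤ R * (D + 1) := one_le_mul_of_one_le_of_one_le hR (by linarith)
            exact one_le_mul_of_one_le_of_one_le this h2
    let f1 : E → ℂ := fun x ↦ (1 - ψ (gR x)) * g x ^ (M + 1)
    let f2 : E → ℂ := fun x ↦ ((R : ℂ)⁻¹) ^ (M + 1) * Ψ (gR x)
    have hf1 : f1.HasTemperateGrowth :=
      ((Function.HasTemperateGrowth.const 1).sub (hψt.comp hgR)).mul (hg.pow _)
    have hf2 : f2.HasTemperateGrowth :=
      (Function.HasTemperateGrowth.const _).mul (hΨt.comp hgR)
    have h1 : T (SchwartzMap.smulLeftCLM ℂ f1 φ) = 0 := by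
      refine T.isVanishingOn_compl_dsupport _ ?_
      refine (SchwartzMap.tsupport_smulLeftCLM_subset f1 φ).trans
        (Set.inter_subset_right.trans ?_)
      have hcl : IsClosed {x | 1 ≤ ‖gR x‖} := isClosed_le continuous_const hgR.1.continuous.norm
      refine (closure_minimal ?_ hcl).trans ?_
      · intro x hx
        by_contra hlt
        simp only [Set.mem_ofPred_eq, not_le] at hlt
        refine hx ?_
        have : b (gR x) = 1 := b.one_of_mem_closedBall (by simpa [b] using hlt.le)
        simp [f1, ψ, this]
      · intro x hx hxT
        simp only [Set.mem_ofPred_eq, gR, hg0 x hxT, mul_zero, norm_zero] at hx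
        linarith
    have h2 : ‖T (SchwartzMap.smulLeftCLM ℂ f2 φ)‖ ≤
        C * ((M.factorial * B * (D + 1) ^ M) * R⁻¹) := by
      refine hC _ _ hf2 (by positivity) fun i hi x ↦ ?_
      have h3 : f2 = ((R⁻¹) ^ (M + 1) : ℝ) • (Ψ ∘ gR) := by
        funext y
        simp [f2]
      rw [h3, iteratedFDeriv_const_smul_apply
        ((hΨt.comp hgR).1.of_le (mod_cast le_top)).contDiffAt,
        norm_smul, Real.norm_of_nonneg (by positivity)]
      have h4 := norm_iteratedFDeriv_comp_le (𝕜 := ℝ) (N := (⊤ : ℕ∞)) hΨs hgR.1 (n := i)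
        (mod_cast le_top) x (C := B) (fun j hj ↦ hB j (hj.trans hi) _)
        (fun j hj hji ↦ hgRd x j hj (hji.trans hi))
      have h5 : 1 ≤ R * (D + 1) * (1 + ‖x‖) ^ k :=
        one_le_mul_of_one_le_of_one_le (one_le_mul_of_one_le_of_one_le hR (by linarith))
          (one_le_pow₀ (by linarith [norm_nonneg x]))
      calc R⁻¹ ^ (M + 1) * ‖iteratedFDeriv ℝ i (Ψ ∘ gR) x‖
          ≤ R⁻¹ ^ (M + 1) * (M.factorial * B * (R * (D + 1) * (1 + ‖x‖) ^ k) ^ M) := by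
            gcongr
            refine h4.trans ?_
            gcongr
        _ = _ := by
            rw [mul_pow, mul_pow, pow_succ, ← pow_mul, inv_pow]
            field_simp
    have h6 : SchwartzMap.smulLeftCLM ℂ (g ^ (M + 1)) φ =
        SchwartzMap.smulLeftCLM ℂ f1 φ + SchwartzMap.smulLeftCLM ℂ f2 φ := by
      ext x
      have hRc : (R : ℂ) ≠ 0 := mod_cast hR0.ne'
      rw [add_apply, SchwartzMap.smulLeftCLM_apply_apply hf1,
        SchwartzMap.smulLeftCLM_apply_apply hf2, SchwartzMap.smulLeftCLM_apply_apply (hg.pow _)]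
      simp only [f1, f2, Ψ, gR, smul_eq_mul, mul_pow, inv_pow, Pi.pow_apply]
      field_simp
      ring
    rw [hT0, h6, map_add, h1, zero_add]
    exact h2
  have hlim : Filter.Tendsto (fun R : ℝ ↦ C * ((M.factorial * B * (D + 1) ^ M) * R⁻¹))
      Filter.atTop (nhds 0) := by
    simpa using (tendsto_inv_atTop_zero.const_mul (M.factorial * B * (D + 1) ^ M)).const_mul C
  exact norm_le_zero_iff.1 (ge_of_tendsto hlim (Filter.eventually_atTop.2 ⟨1, hest⟩))

end support

/-! ### Modulations, shifts, linear forms, derivatives: commutation relations and Fourier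
transforms. -/

section operators

variable {n : ℕ}

theorem planeWave_comm (η x : En n) : planeWave η x = planeWave x η := by
  rw [planeWave, planeWave, real_inner_comm]

theorem planeWave_add_right (η x y : En n) :
    planeWave η (x + y) = planeWave η x * planeWave η y := by
  rw [planeWave, planeWave, planeWave, ← Complex.exp_add, inner_add_right]
  push_cast
  ring_nf

theorem planeWave_add_left (η ξ x : En n) :
    planeWave (η + ξ) x = planeWave η x * planeWave ξ x := by
  rw [planeWave_comm, planeWave_add_right, planeWave_comm, planeWave_comm x]

@[simp]
theorem planeWave_zero_left (x : En n) : planeWave 0 x = 1 := by simp [planeWave]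

@[simp]
theorem planeWave_zero_right (x : En n) : planeWave x 0 = 1 := by simp [planeWave]

theorem planeWave_ne_zero (η x : En n) : planeWave η x ≠ 0 := Complex.exp_ne_zero _

theorem planeWave_neg_left (η x : En n) : planeWave (-η) x = (planeWave η x)⁻¹ := by
  refine eq_inv_of_mul_eq_one_left ?_
  rw [← planeWave_add_left]
  simp

theorem planeWave_neg_right (η x : En n) : planeWave η (-x) = (planeWave η x)⁻¹ := by
  rw [planeWave_comm, planeWave_neg_left, planeWave_comm]

theorem planeWave_sub_right (η x y : En n) :
    planeWave η (x - y) = planeWave η x * (planeWave η y)⁻¹ := by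
  rw [sub_eq_add_neg, planeWave_add_right, planeWave_neg_right]

theorem planeWave_eq_one_iff {η x : En n} : planeWave η x = 1 ↔ ∃ m : ℤ, (m : ℝ) = inner ℝ η x := by
  rw [planeWave, Complex.exp_eq_one_iff]
  have h : (2 * Real.pi * Complex.I : ℂ) ≠ 0 := Complex.two_pi_I_ne_zero
  refine exists_congr fun m ↦ ⟨fun hm ↦ ?_, fun hm ↦ ?_⟩
  · have : ((inner ℝ η x : ℝ) : ℂ) = (m : ℝ) := by
      apply mul_left_cancel₀ h
      rw [hm]
      push_cast
      ring
    exact_mod_cast this.symm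
  · rw [← hm]
    push_cast
    ring

theorem expMul_eq_smulLeftCLM (η : En n) :
    expMul η = TemperedDistribution.smulLeftCLM ℂ (planeWave η) := rfl

theorem expMul_apply_apply (η : En n) (t : 𝓢'(En n, ℂ)) (φ : 𝓢(En n, ℂ)) :
    expMul η t φ = t (SchwartzMap.smulLeftCLM ℂ (planeWave η) φ) := rfl

theorem shiftBy_apply_apply (η : En n) (t : 𝓢'(En n, ℂ)) (φ : 𝓢(En n, ℂ)) :
    shiftBy η t φ = t (SchwartzMap.compSubConstCLM ℂ (-η) φ) := rfl

theorem smulLeftCLM_mul_smulLeftCLM {g₁ g₂ : En n → ℂ} (h₁ : g₁.HasTemperateGrowth)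
    (h₂ : g₂.HasTemperateGrowth) :
    (TemperedDistribution.smulLeftCLM ℂ g₁ * TemperedDistribution.smulLeftCLM ℂ g₂ : DistOp n) =
      TemperedDistribution.smulLeftCLM ℂ (g₁ * g₂) := by
  ext1 t
  rw [mul_comm g₁]
  exact TemperedDistribution.smulLeftCLM_smulLeftCLM_apply h₂ h₁ t

theorem commute_smulLeftCLM {g₁ g₂ : En n → ℂ} (h₁ : g₁.HasTemperateGrowth)
    (h₂ : g₂.HasTemperateGrowth) :
    Commute (TemperedDistribution.smulLeftCLM ℂ g₁ : DistOp n)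
      (TemperedDistribution.smulLeftCLM ℂ g₂) := by
  rw [Commute, SemiconjBy, smulLeftCLM_mul_smulLeftCLM h₁ h₂, smulLeftCLM_mul_smulLeftCLM h₂ h₁,
    mul_comm]

theorem smulLeftCLM_pow {g : En n → ℂ} (h : g.HasTemperateGrowth) (N : ℕ) :
    (TemperedDistribution.smulLeftCLM ℂ (g ^ N) : DistOp n) =
      TemperedDistribution.smulLeftCLM ℂ g ^ N := by
  induction N with
  | zero =>
    ext1 t
    rw [pow_zero, pow_zero]
    exact (TemperedDistribution.smulLeftCLM_const 1 t).trans (one_smul _ _)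
  | succ N ih =>
    rw [pow_succ, pow_succ, ← ih, smulLeftCLM_mul_smulLeftCLM (h.pow N) h]

theorem expMul_add (ξ η : En n) : expMul (ξ + η) = expMul ξ * expMul η := by
  rw [expMul_eq_smulLeftCLM, expMul_eq_smulLeftCLM, expMul_eq_smulLeftCLM,
    smulLeftCLM_mul_smulLeftCLM (hasTemperateGrowth_planeWave _) (hasTemperateGrowth_planeWave _)]
  congr 1
  funext x
  exact planeWave_add_left ξ η x

theorem expMul_zero : expMul (0 : En n) = 1 := by
  have h : planeWave (0 : En n) = fun _ ↦ 1 := funext planeWave_zero_left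
  rw [expMul_eq_smulLeftCLM, h]
  ext1 t
  exact (TemperedDistribution.smulLeftCLM_const 1 t).trans (one_smul _ _)

theorem expMul_neg_expMul (η : En n) (t : 𝓢'(En n, ℂ)) : expMul (-η) (expMul η t) = t := by
  have h := expMul_add (-η) η
  rw [neg_add_cancel, expMul_zero] at h
  exact (DFunLike.congr_fun h t).symm

theorem expMul_expMul_neg (η : En n) (t : 𝓢'(En n, ℂ)) : expMul η (expMul (-η) t) = t := by
  simpa using expMul_neg_expMul (-η) t

theorem shiftBy_add (p q : En n) : shiftBy (p + q) = shiftBy p * shiftBy q := by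
  ext t φ
  change t (SchwartzMap.compSubConstCLM ℂ (-(p + q)) φ) =
    t (SchwartzMap.compSubConstCLM ℂ (-q) (SchwartzMap.compSubConstCLM ℂ (-p) φ))
  congr 1
  ext x
  simp only [SchwartzMap.compSubConstCLM_apply]
  congr 1
  abel

theorem shiftBy_zero : shiftBy (0 : En n) = 1 := by
  ext t φ
  change t (SchwartzMap.compSubConstCLM ℂ (-0) φ) = t φ
  congr 1
  ext x
  simp

theorem shiftBy_neg_shiftBy (p : En n) (t : 𝓢'(En n, ℂ)) : shiftBy (-p) (shiftBy p t) = t := by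
  have h := shiftBy_add (-p) p
  rw [neg_add_cancel, shiftBy_zero] at h
  exact (DFunLike.congr_fun h t).symm

/-- The Weyl relation. Its phase is 1 when `ξ` and `p` lie in dual lattices; in general, the phase
being a root of unity expresses rationality of `⟨ξ,p⟩`. -/
theorem expMul_mul_shiftBy (ξ p : En n) :
    expMul ξ * shiftBy p = planeWave ξ p • (shiftBy p * expMul ξ) := by
  ext t φ
  change t (SchwartzMap.compSubConstCLM ℂ (-p) (SchwartzMap.smulLeftCLM ℂ (planeWave ξ) φ)) =
    planeWave ξ p • t (SchwartzMap.smulLeftCLM ℂ (planeWave ξ) (SchwartzMap.compSubConstCLM ℂ (-p) φ))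
  rw [← map_smul]
  congr 1
  ext x
  simp only [SchwartzMap.compSubConstCLM_apply, smul_apply,
    SchwartzMap.smulLeftCLM_apply_apply (hasTemperateGrowth_planeWave ξ), sub_neg_eq_add,
    planeWave_add_right, smul_eq_mul]
  ring

/-- Multiplication by the linear form `⟨ξ, x⟩`. -/
noncomputable def innerMul (ξ : En n) : DistOp n :=
  TemperedDistribution.smulLeftCLM ℂ fun x : En n ↦ ((inner ℝ ξ x : ℝ) : ℂ)

/-- The derivative in the direction `p`. -/
noncomputable def dirD (p : En n) : DistOp n := LineDeriv.lineDerivOpCLM ℂ 𝓢'(En n, ℂ) p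

theorem hasTemperateGrowth_inner_ofReal (ξ : En n) :
    (fun x : En n ↦ ((inner ℝ ξ x : ℝ) : ℂ)).HasTemperateGrowth :=
  Function.Complex.hasTemperateGrowth_ofReal.comp (Function.hasTemperateGrowth_inner_right ξ)

theorem hasTemperateGrowth_coord (i : Fin n) :
    (fun x : En n ↦ ((x i : ℝ) : ℂ)).HasTemperateGrowth :=
  Function.Complex.hasTemperateGrowth_ofReal.comp
    (EuclideanSpace.proj (𝕜 := ℝ) i : En n →L[ℝ] ℝ).hasTemperateGrowth

theorem innerMul_eq_sum (ξ : En n) : innerMul ξ = ∑ i, ((ξ i : ℝ) : ℂ) • mulX i := by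
  have h1 : (fun x : En n ↦ ((inner ℝ ξ x : ℝ) : ℂ)) =
      fun x ↦ ∑ i, (((ξ i : ℝ) : ℂ) • fun x : En n ↦ ((x i : ℝ) : ℂ)) x := by
    funext x
    rw [PiLp.inner_apply]
    push_cast
    refine Finset.sum_congr rfl fun i _ ↦ ?_
    simp [mul_comm]
  rw [innerMul, h1, TemperedDistribution.smulLeftCLM_sum]
  · refine Finset.sum_congr rfl fun i _ ↦ ?_
    exact TemperedDistribution.smulLeftCLM_smul (hasTemperateGrowth_coord i) _
  · intro i _
    exact (Function.HasTemperateGrowth.const ((ξ i : ℝ) : ℂ)).mul (hasTemperateGrowth_coord i)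

theorem dirD_apply_apply (p : En n) (t : 𝓢'(En n, ℂ)) (φ : 𝓢(En n, ℂ)) :
    dirD p t φ = t (-(∂_{p} φ)) := TemperedDistribution.lineDerivOp_apply_apply t φ p

theorem dirD_eq_sum (p : En n) : dirD p = ∑ i, ((p i : ℝ) : ℂ) • partialD i := by
  ext t φ
  have hp : p = ∑ i, (p i : ℝ) • EuclideanSpace.single i (1 : ℝ) := by
    ext j
    simp [Pi.single_apply]
  have h1 : ∂_{p} φ = ∑ i, ((p i : ℝ) : ℂ) • ∂_{EuclideanSpace.single i (1 : ℝ)} φ := by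
    ext x
    rw [sum_apply, SchwartzMap.lineDerivOp_apply_eq_fderiv]
    conv_lhs => rw [hp, map_sum]
    refine Finset.sum_congr rfl fun i _ ↦ ?_
    rw [map_smul, smul_apply, SchwartzMap.lineDerivOp_apply_eq_fderiv]
    simp
  rw [dirD_apply_apply, h1, sum_apply, ← Finset.sum_neg_distrib, map_sum]
  have h2 : ∀ s : Finset (Fin n), (∑ i ∈ s, (((p i : ℝ) : ℂ) • partialD i) t) φ =
      ∑ i ∈ s, ((((p i : ℝ) : ℂ) • partialD i) t) φ := fun s ↦ by
    induction s using Finset.cons_induction with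
    | empty => rfl
    | cons a s ha ih => rw [Finset.sum_cons, Finset.sum_cons, ← ih]; rfl
  rw [h2]
  refine Finset.sum_congr rfl fun i _ ↦ ?_
  rw [← smul_neg, map_smul]
  rfl

/-- This is `T X = (X + c) T` with `c = -⟨ξ,p⟩`, as needed in `mem_of_genEigenvector`. For dual
bases `c` is `-1` or `0`. -/
theorem shiftBy_mul_innerMul (p ξ : En n) :
    shiftBy p * innerMul ξ = (innerMul ξ - ((inner ℝ ξ p : ℝ) : ℂ) • 1) * shiftBy p := by
  ext t φ
  change t (SchwartzMap.smulLeftCLM ℂ (fun x ↦ ((inner ℝ ξ x : ℝ) : ℂ))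
      (SchwartzMap.compSubConstCLM ℂ (-p) φ)) =
    t (SchwartzMap.compSubConstCLM ℂ (-p) (SchwartzMap.smulLeftCLM ℂ
      (fun x ↦ ((inner ℝ ξ x : ℝ) : ℂ)) φ)) -
    ((inner ℝ ξ p : ℝ) : ℂ) • t (SchwartzMap.compSubConstCLM ℂ (-p) φ)
  rw [← map_smul, ← map_sub]
  congr 1
  ext x
  simp only [SchwartzMap.compSubConstCLM_apply, smul_apply, sub_apply,
    SchwartzMap.smulLeftCLM_apply_apply (hasTemperateGrowth_inner_ofReal ξ), sub_neg_eq_add,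
    inner_add_right, smul_eq_mul]
  push_cast
  ring

/-- The Fourier counterpart of `shiftBy_mul_innerMul`, by the product rule: here `c = -2πi⟨ξ,p⟩`. -/
theorem expMul_mul_dirD (ξ p : En n) :
    expMul ξ * dirD p =
      (dirD p - (2 * Real.pi * Complex.I * ((inner ℝ ξ p : ℝ) : ℂ)) • 1) * expMul ξ := by
  ext t φ
  change t (-(∂_{p} (SchwartzMap.smulLeftCLM ℂ (planeWave ξ) φ))) =
    t (SchwartzMap.smulLeftCLM ℂ (planeWave ξ) (-(∂_{p} φ))) -
    (2 * Real.pi * Complex.I * ((inner ℝ ξ p : ℝ) : ℂ)) •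
      t (SchwartzMap.smulLeftCLM ℂ (planeWave ξ) φ)
  rw [← map_smul, ← map_sub]
  congr 1
  ext x
  have hd : HasFDerivAt (fun x ↦ planeWave ξ x * φ x) (planeWave ξ x • fderiv ℝ φ x + φ x •
      (planeWave ξ x • ((2 * Real.pi * Complex.I) • (Complex.ofRealCLM.comp (innerSL ℝ ξ))))) x := by
    refine HasFDerivAt.mul ?_ (φ.hasFDerivAt x)
    have h1 : HasFDerivAt (fun x : En n ↦ ((inner ℝ ξ x : ℝ) : ℂ))
      (Complex.ofRealCLM.comp (innerSL ℝ ξ)) x := (Complex.ofRealCLM.comp (innerSL ℝ ξ)).hasFDerivAt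
    exact (h1.const_mul (2 * Real.pi * Complex.I)).cexp
  have hg := hasTemperateGrowth_planeWave ξ
  have h2 : (SchwartzMap.smulLeftCLM ℂ (planeWave ξ) φ : En n → ℂ) =
      fun x ↦ planeWave ξ x * φ x := by
    funext y
    rw [SchwartzMap.smulLeftCLM_apply_apply hg, smul_eq_mul]
  rw [sub_apply, neg_apply, smul_apply, SchwartzMap.lineDerivOp_apply_eq_fderiv, h2, hd.fderiv,
    SchwartzMap.smulLeftCLM_apply_apply hg, neg_apply, SchwartzMap.lineDerivOp_apply_eq_fderiv]
  simp only [add_apply, smul_apply, ContinuousLinearMap.comp_apply, innerSL_apply_apply,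
    Complex.ofRealCLM_apply, smul_eq_mul]
  ring

theorem commute_mulX (i j : Fin n) : Commute (mulX i : DistOp n) (mulX j) :=
  commute_smulLeftCLM (hasTemperateGrowth_coord i) (hasTemperateGrowth_coord j)

theorem commute_expMul_innerMul (ξ η : En n) : Commute (expMul ξ) (innerMul η) :=
  commute_smulLeftCLM (hasTemperateGrowth_planeWave ξ) (hasTemperateGrowth_inner_ofReal η)

theorem commute_expMul (ξ η : En n) : Commute (expMul ξ) (expMul η) :=
  commute_smulLeftCLM (hasTemperateGrowth_planeWave ξ) (hasTemperateGrowth_planeWave η)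

theorem commute_shiftBy (p q : En n) : Commute (shiftBy p) (shiftBy q) := by
  rw [Commute, SemiconjBy, ← shiftBy_add, ← shiftBy_add, add_comm]

theorem commute_shiftBy_dirD (p q : En n) : Commute (shiftBy p) (dirD q) := by
  ext t φ
  change t (-(∂_{q} (SchwartzMap.compSubConstCLM ℂ (-p) φ))) =
    t (SchwartzMap.compSubConstCLM ℂ (-p) (-(∂_{q} φ)))
  congr 1
  ext x
  rw [neg_apply, SchwartzMap.compSubConstCLM_apply, neg_apply,
    SchwartzMap.lineDerivOp_apply_eq_fderiv, SchwartzMap.lineDerivOp_apply_eq_fderiv]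
  congr 2
  have h2 : ((SchwartzMap.compSubConstCLM ℂ (-p) φ : 𝓢(En n, ℂ)) : En n → ℂ) =
      fun y ↦ φ (y + p) := by
    funext y
    simp
  rw [h2, fderiv_comp_add_right, sub_neg_eq_add]

theorem fourier_expMul (η : En n) (t : 𝓢'(En n, ℂ)) :
    𝓕 (expMul η t) = shiftBy η (𝓕 t : 𝓢'(En n, ℂ)) := by
  ext φ
  change t (SchwartzMap.smulLeftCLM ℂ (planeWave η) (𝓕 φ)) =
    t (𝓕 (SchwartzMap.compSubConstCLM ℂ (-η) φ))
  congr 1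
  ext x
  rw [SchwartzMap.smulLeftCLM_apply_apply (hasTemperateGrowth_planeWave η),
    SchwartzMap.fourier_coe, SchwartzMap.fourier_coe]
  have h := congrFun (VectorFourier.fourierIntegral_comp_add_right Real.fourierChar
    MeasureTheory.volume (innerₗ (En n)) φ η) x
  have h2 : ((SchwartzMap.compSubConstCLM ℂ (-η) φ : 𝓢(En n, ℂ)) : En n → ℂ) =
      φ ∘ fun v ↦ v + η := by
    funext y
    simp
  rw [h2]
  refine Eq.trans ?_ h.symm
  rw [Circle.smul_def, Real.fourierChar_apply, planeWave]
  congr 2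
  simp
  ring

theorem fourier_shiftBy (p : En n) (t : 𝓢'(En n, ℂ)) :
    𝓕 (shiftBy p t) = expMul (-p) (𝓕 t : 𝓢'(En n, ℂ)) := by
  ext φ
  change t (SchwartzMap.compSubConstCLM ℂ (-p) (𝓕 φ)) =
    t (𝓕 (SchwartzMap.smulLeftCLM ℂ (planeWave (-p)) φ))
  congr 1
  ext x
  rw [SchwartzMap.compSubConstCLM_apply, SchwartzMap.fourier_coe, SchwartzMap.fourier_coe,
    Real.fourier_eq', Real.fourier_eq']
  congr 1
  funext y
  rw [SchwartzMap.smulLeftCLM_apply_apply (hasTemperateGrowth_planeWave (-p)), smul_eq_mul,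
    smul_eq_mul, smul_eq_mul, ← mul_assoc, planeWave, ← Complex.exp_add, sub_neg_eq_add,
    inner_add_right, inner_neg_left, real_inner_comm p y]
  congr 2
  push_cast
  ring

theorem fourier_mulX (i : Fin n) (t : 𝓢'(En n, ℂ)) :
    𝓕 (mulX i t) = (-(2 * Real.pi * Complex.I)⁻¹ : ℂ) • partialD i (𝓕 t : 𝓢'(En n, ℂ)) := by
  have h := TemperedDistribution.lineDerivOp_fourier_eq t (EuclideanSpace.single i (1 : ℝ))
  have h2 : (fun x : En n ↦ ((inner ℝ x (EuclideanSpace.single i (1 : ℝ)) : ℝ) : ℂ)) =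
      fun x : En n ↦ ((x i : ℝ) : ℂ) := by
    funext x
    rw [EuclideanSpace.inner_single_right]
    simp
  have h3 : partialD i (𝓕 t : 𝓢'(En n, ℂ)) =
      𝓕 ((-(2 * Real.pi * Complex.I) : ℂ) • mulX i t) := by
    rw [mulX, ← h2]
    exact h
  have h0 : (2 * Real.pi * Complex.I : ℂ) ≠ 0 := Complex.two_pi_I_ne_zero
  rw [h3, FourierTransform.fourier_smul, smul_smul, neg_mul_neg, inv_mul_cancel₀ h0, one_smul]

theorem fourier_partialD (i : Fin n) (t : 𝓢'(En n, ℂ)) :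
    𝓕 (partialD i t) = (2 * Real.pi * Complex.I : ℂ) • mulX i (𝓕 t : 𝓢'(En n, ℂ)) := by
  have h := TemperedDistribution.fourier_lineDerivOp_eq t (EuclideanSpace.single i (1 : ℝ))
  have h2 : (fun x : En n ↦ ((inner ℝ x (EuclideanSpace.single i (1 : ℝ)) : ℝ) : ℂ)) =
      fun x : En n ↦ ((x i : ℝ) : ℂ) := by
    funext x
    rw [EuclideanSpace.inner_single_right]
    simp
  rw [mulX, ← h2]
  exact h

theorem fourier_injective : Function.Injective fun t : 𝓢'(En n, ℂ) ↦ (𝓕 t : 𝓢'(En n, ℂ)) :=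
  Function.LeftInverse.injective (g := fun t ↦ 𝓕⁻ t) FourierTransform.fourierInv_fourier_eq

/-- On the Fourier side the derivatives become coordinate multiplications. -/
theorem commute_partialD (i j : Fin n) : Commute (partialD i : DistOp n) (partialD j) := by
  ext1 t
  apply fourier_injective
  change (𝓕 (partialD i (partialD j t)) : 𝓢'(En n, ℂ)) = 𝓕 (partialD j (partialD i t))
  simp only [fourier_partialD, map_smul]
  congr 2
  exact DFunLike.congr_fun (commute_mulX i j) _

end operators

/-! ### Dual bases and the dual lattice. -/

section lattice

variable {n : ℕ}

/-- A pair of dual bases `p`, `ξ` of a lattice and its dual lattice. -/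
structure IsDualBases (L : Submodule ℤ (En n)) (p ξ : Fin n → En n) : Prop where
  inner_eq : ∀ j k, inner ℝ (ξ j) (p k) = if j = k then (1 : ℝ) else 0
  sum_left : ∀ x, x = ∑ j, (inner ℝ (ξ j) x : ℝ) • p j
  sum_right : ∀ x, x = ∑ j, (inner ℝ x (p j) : ℝ) • ξ j
  mem_iff : ∀ x, x ∈ L ↔ ∀ j, ∃ m : ℤ, (m : ℝ) = inner ℝ (ξ j) x
  mem_dual_iff : ∀ x, x ∈ dualLattice L ↔ ∀ j, ∃ m : ℤ, (m : ℝ) = inner ℝ x (p j)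

/-- A ℤ-basis of `L` is an ℝ-basis of the space, and `ξ` is its dual basis for the inner product;
membership in either lattice then means integral coordinates. -/
theorem exists_isDualBases (L : Submodule ℤ (En n)) [DiscreteTopology L] [IsZLattice ℝ L] :
    ∃ p ξ, IsDualBases L p ξ := by
  classical
  have hB : LinearMap.BilinForm.Nondegenerate (innerₗ (En n)) := by
    constructor
    · intro x hx
      exact inner_self_eq_zero.1 (hx x)
    · intro x hx
      exact inner_self_eq_zero.1 (hx x)
  have : Module.Finite ℤ L := ZLattice.module_finite ℝ L
  have : Module.Free ℤ L := ZLattice.module_free ℝ L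
  let b0 := (Module.Free.chooseBasis ℤ L).ofZLatticeBasis ℝ L
  have hcard : Fintype.card (Module.Free.ChooseBasisIndex ℤ L) = n := by
    rw [← Module.finrank_eq_card_basis b0]
    simp
  let b := b0.reindex (Fintype.equivFinOfCardEq hcard)
  have hspan : Submodule.span ℤ (Set.range b) = L := by
    rw [Module.Basis.range_reindex]
    exact Module.Basis.ofZLatticeBasis_span ℝ L _
  let d := LinearMap.BilinForm.dualBasis (innerₗ (En n)) hB b
  have hdb : ∀ j k, inner ℝ (d j) (b k) = if j = k then (1 : ℝ) else 0 := fun j k ↦ by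
    have := LinearMap.BilinForm.apply_dualBasis_left (B := innerₗ (En n)) hB b j k
    rw [innerₗ_apply_apply] at this
    rw [this]
    simp only [eq_comm]
  have hsum_left : ∀ x, x = ∑ j, (inner ℝ (d j) x : ℝ) • b j := fun x ↦ by
    have hrepr : ∀ j, inner ℝ (d j) x = b.repr x j := fun j ↦ by
      have h1 : inner ℝ (d j) (∑ i, b.repr x i • b i) = b.repr x j := by
        rw [inner_sum]
        simp [inner_smul_right, hdb]
      rwa [b.sum_repr x] at h1
    simp only [hrepr]
    exact (b.sum_repr x).symm
  have hrepr_r : ∀ x j, d.repr x j = inner ℝ x (b j) := fun x j ↦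
    LinearMap.BilinForm.dualBasis_repr_apply (B := innerₗ (En n)) hB b x j
  have hsum_right : ∀ x, x = ∑ j, (inner ℝ x (b j) : ℝ) • d j := fun x ↦ by
    simp only [← hrepr_r]
    exact (d.sum_repr x).symm
  have hbL : ∀ j, b j ∈ L := fun j ↦ by
    rw [← hspan]
    exact Submodule.subset_span ⟨j, rfl⟩
  refine ⟨b, d, hdb, hsum_left, hsum_right, fun x ↦ ⟨fun hx j ↦ ?_, fun hx ↦ ?_⟩,
    fun x ↦ ⟨fun hx j ↦ ?_, fun hx ↦ ?_⟩⟩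
  · rw [← hspan] at hx
    induction hx using Submodule.span_induction with
    | mem y hy =>
      obtain ⟨k, rfl⟩ := hy
      exact ⟨if j = k then 1 else 0, by rw [hdb]; split_ifs <;> simp⟩
    | zero => exact ⟨0, by simp⟩
    | add y z _ _ hy hz =>
      obtain ⟨a, ha⟩ := hy
      obtain ⟨c, hc⟩ := hz
      exact ⟨a + c, by rw [inner_add_right, ← ha, ← hc]; push_cast; rfl⟩
    | smul a y _ hy =>
      obtain ⟨c, hc⟩ := hy
      refine ⟨a * c, ?_⟩
      rw [← Int.cast_smul_eq_zsmul ℝ, inner_smul_right, ← hc]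
      push_cast
      rfl
  · choose m hm using hx
    rw [hsum_left x]
    refine Submodule.sum_mem _ fun j _ ↦ ?_
    rw [← hm, Int.cast_smul_eq_zsmul]
    exact Submodule.smul_mem _ _ (hbL j)
  · exact mem_dualLattice.1 hx _ (hbL j)
  · choose m hm using hx
    refine mem_dualLattice.2 fun y hy ↦ ?_
    rw [← hspan] at hy
    induction hy using Submodule.span_induction with
    | mem y hy =>
      obtain ⟨k, rfl⟩ := hy
      exact ⟨m k, hm k⟩
    | zero => exact ⟨0, by simp⟩
    | add y z _ _ hy hz =>
      obtain ⟨a, ha⟩ := hy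
      obtain ⟨c, hc⟩ := hz
      exact ⟨a + c, by rw [inner_add_right, ← ha, ← hc]; push_cast; rfl⟩
    | smul a y _ hy =>
      obtain ⟨c, hc⟩ := hy
      refine ⟨a * c, ?_⟩
      rw [← Int.cast_smul_eq_zsmul ℝ, inner_smul_right, ← hc]
      push_cast
      rfl

namespace IsDualBases

variable {L : Submodule ℤ (En n)} {p ξ : Fin n → En n}

theorem left_mem (h : IsDualBases L p ξ) (j : Fin n) : p j ∈ L :=
  (h.mem_iff _).2 fun k ↦ ⟨if k = j then 1 else 0, by rw [h.inner_eq]; split_ifs <;> simp⟩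

theorem right_mem (h : IsDualBases L p ξ) (j : Fin n) : ξ j ∈ dualLattice L :=
  (h.mem_dual_iff _).2 fun k ↦ ⟨if j = k then 1 else 0, by rw [h.inner_eq]; split_ifs <;> simp⟩

theorem mem_dual_dual (h : IsDualBases L p ξ) {x : En n} :
    x ∈ dualLattice (dualLattice L) ↔ x ∈ L := by
  refine ⟨fun hx ↦ (h.mem_iff x).2 fun j ↦ ?_, fun hx ↦ mem_dualLattice.2 fun y hy ↦ ?_⟩
  · rw [real_inner_comm]
    exact mem_dualLattice.1 hx _ (h.right_mem j)
  · rw [real_inner_comm]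
    exact mem_dualLattice.1 hy _ hx

theorem symm (h : IsDualBases L p ξ) : IsDualBases (dualLattice L) ξ p where
  inner_eq j k := by rw [real_inner_comm, h.inner_eq]; simp only [eq_comm]
  sum_left x := by simpa only [real_inner_comm] using h.sum_right x
  sum_right x := by simpa only [real_inner_comm] using h.sum_left x
  mem_iff x := by simpa only [real_inner_comm] using h.mem_dual_iff x
  mem_dual_iff x := by
    rw [h.mem_dual_dual]
    simpa only [real_inner_comm] using h.mem_iff x

theorem isZLattice_dual [DiscreteTopology (dualLattice L)] (h : IsDualBases L p ξ) :
    IsZLattice ℝ (dualLattice L) := by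
  refine ⟨eq_top_iff.2 fun x _ ↦ ?_⟩
  rw [h.sum_right x]
  exact Submodule.sum_mem _ fun j _ ↦ Submodule.smul_mem _ _ (Submodule.subset_span (h.right_mem j))

end IsDualBases

instance isZLattice_dualLattice (L : Submodule ℤ (En n)) [DiscreteTopology L] [IsZLattice ℝ L] :
    IsZLattice ℝ (dualLattice L) := by
  obtain ⟨p, ξ, h⟩ := exists_isDualBases L
  exact h.isZLattice_dual

theorem dualLattice_dualLattice (L : Submodule ℤ (En n)) [DiscreteTopology L] [IsZLattice ℝ L] :
    dualLattice (dualLattice L) = L := by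
  obtain ⟨p, ξ, h⟩ := exists_isDualBases L
  ext x
  exact h.mem_dual_dual

theorem planeWave_eq_one_of_mem {L : Submodule ℤ (En n)} {ξ p : En n} (hξ : ξ ∈ dualLattice L)
    (hp : p ∈ L) : planeWave ξ p = 1 :=
  planeWave_eq_one_iff.2 (mem_dualLattice.1 hξ p hp)

end lattice

/-! ### Division by linear forms and by `θ`. -/

section hadamard

open MeasureTheory in
/-- Hadamard's lemma: a smooth function differs from its value at `s` by a smooth linear form
in `y - s`. -/
theorem exists_contDiff_sub_eq_apply {E : Type*} [NormedAddCommGroup E] [NormedSpace ℝ E]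
    [FiniteDimensional ℝ E] {f : E → ℂ} (hf : ContDiff ℝ (⊤ : ℕ∞) f) (s : E) :
    ∃ h : E → E →L[ℝ] ℂ, ContDiff ℝ (⊤ : ℕ∞) h ∧ ∀ y, f y - f s = h y (y - s) := by
  let b : ContDiffBump (0 : ℝ) := ⟨1, 2, one_pos, one_lt_two⟩
  -- Smooth dependence of `∫₀¹ f'(s + τ(y - s)) dτ` on `y` is read off from a convolution with the
  -- indicator of `[0,1]`, evaluated at 0. This explains the sign of `τ`; the bump, equal to 1 on
  -- `[-1,1]`, only makes the kernel compactly supported.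
  let g : E → ℝ → E →L[ℝ] ℂ := fun y τ ↦ b τ • fderiv ℝ f (s + (-τ) • (y - s))
  have hfd : ContDiff ℝ (⊤ : ℕ∞) (fderiv ℝ f) := hf.fderiv_right (by simp)
  have hg : ContDiff ℝ (⊤ : ℕ∞) ↿g := by
    have h1 : ContDiff ℝ (⊤ : ℕ∞) fun z : E × ℝ ↦ b z.2 := b.contDiff.comp contDiff_snd
    have h2 : ContDiff ℝ (⊤ : ℕ∞) fun z : E × ℝ ↦ s + (-z.2) • (z.1 - s) := by fun_prop
    exact h1.smul (hfd.comp h2)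
  have hloc : LocallyIntegrable (Set.indicator (Set.Icc (0 : ℝ) 1) fun _ ↦ (1 : ℝ)) := by
    refine Integrable.locallyIntegrable ?_
    rw [integrable_indicator_iff measurableSet_Icc]
    exact continuous_const.integrableOn_Icc
  have hconv := contDiffOn_convolution_right_with_param_comp (𝕜 := ℝ) (μ := volume)
    (ContinuousLinearMap.lsmul ℝ ℝ : ℝ →L[ℝ] (E →L[ℝ] ℂ) →L[ℝ] E →L[ℝ] ℂ)
    (v := fun _ : E ↦ (0 : ℝ)) (s := Set.univ) contDiffOn_const (g := g)
    (k := Metric.closedBall 0 2) isOpen_univ (isCompact_closedBall 0 2)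
    (fun y τ _ hτ ↦ by
      have : b τ = 0 := b.zero_of_le_dist (by
        simp only [Metric.mem_closedBall, not_le] at hτ
        exact hτ.le)
      simp only [g, this]
      exact zero_smul ℝ (fderiv ℝ f (s + -τ • (y - s)))) hloc (n := ⊤) hg.contDiffOn
  refine ⟨_, contDiffOn_univ.1 hconv, fun y ↦ ?_⟩
  have hint : ∀ y, (convolution (Set.indicator (Set.Icc (0 : ℝ) 1) fun _ ↦ (1 : ℝ)) (g y)
      (ContinuousLinearMap.lsmul ℝ ℝ : ℝ →L[ℝ] (E →L[ℝ] ℂ) →L[ℝ] E →L[ℝ] ℂ) volume) 0 =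
      ∫ τ in (0 : ℝ)..1, fderiv ℝ f (s + τ • (y - s)) := fun y ↦ by
    rw [convolution_def, intervalIntegral.integral_of_le zero_le_one,
      ← integral_Icc_eq_integral_Ioc, ← integral_indicator measurableSet_Icc]
    congr 1
    funext τ
    by_cases hτ : τ ∈ Set.Icc (0 : ℝ) 1
    · have : b (-τ) = 1 := b.one_of_mem_closedBall (by
        simpa [b, abs_of_nonneg hτ.1] using hτ.2)
      simp [g, hτ, this]
    · simp [hτ]
  rw [hint, ContinuousLinearMap.intervalIntegral_apply]
  · have hc : Continuous fun τ : ℝ ↦ fderiv ℝ f (s + τ • (y - s)) (y - s) :=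
      (hfd.continuous.comp (by fun_prop)).clm_apply continuous_const
    rw [intervalIntegral.integral_eq_sub_of_hasDerivAt (f := fun τ : ℝ ↦ f (s + τ • (y - s)))]
    · simp
    · intro τ _
      have h1 : HasDerivAt (fun τ : ℝ ↦ s + τ • (y - s)) (y - s) τ := by
        simpa using ((hasDerivAt_id τ).smul_const (y - s)).const_add s
      exact ((hf.differentiable (by simp)).differentiableAt.hasFDerivAt).comp_hasDerivAt τ h1
    · exact hc.intervalIntegrable _ _
  · exact (hfd.continuous.comp (by fun_prop)).intervalIntegrable _ _

/-- The quotient `(exp(2πiθ) - 1) / θ` extends to a smooth function that does not vanish on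
`(-1, 1)`. -/
theorem exists_contDiff_cexp_sub_one_eq :
    ∃ k : ℝ → ℂ, ContDiff ℝ (⊤ : ℕ∞) k ∧ (∀ θ : ℝ, |θ| < 1 → k θ ≠ 0) ∧
      ∀ θ : ℝ, Complex.exp (2 * Real.pi * Complex.I * θ) - 1 = θ * k θ := by
  let F : ℂ → ℂ := fun z ↦ Complex.exp (2 * Real.pi * Complex.I * z)
  have hF : Differentiable ℂ F := by fun_prop
  have hd : Differentiable ℂ (dslope F 0) := by
    rw [← differentiableOn_univ, Complex.differentiableOn_dslope Filter.univ_mem]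
    exact hF.differentiableOn
  -- The divided difference of an entire function is entire. For `|θ| < 1`, `exp(2πiθ) = 1` only at
  -- `θ = 0`, where the quotient equals `2πi`.
  refine ⟨fun θ ↦ dslope F 0 θ, ?_, fun θ hθ ↦ ?_, fun θ ↦ ?_⟩
  · exact (hd.contDiff.restrict_scalars ℝ).comp Complex.ofRealCLM.contDiff
  · by_cases h0 : θ = 0
    · subst h0
      change dslope F 0 ((0 : ℝ) : ℂ) ≠ 0
      rw [Complex.ofReal_zero, dslope_same]
      have : HasDerivAt F (Complex.exp (2 * Real.pi * Complex.I * 0) *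
          (2 * Real.pi * Complex.I * 1)) 0 :=
        ((hasDerivAt_id (0 : ℂ)).const_mul (2 * Real.pi * Complex.I)).cexp
      rw [this.deriv]
      simp [Real.pi_ne_zero]
    · change dslope F 0 (θ : ℂ) ≠ 0
      rw [dslope_of_ne _ (by exact_mod_cast h0), slope_def_field]
      refine div_ne_zero ?_ (by simpa using h0)
      simp only [F, mul_zero, Complex.exp_zero, sub_ne_zero]
      rw [Ne, Complex.exp_eq_one_iff]
      rintro ⟨m, hm⟩
      have h1 : (θ : ℂ) = (m : ℝ) := by
        apply mul_left_cancel₀ Complex.two_pi_I_ne_zero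
        rw [hm]
        push_cast
        ring
      have h2 : θ = m := by exact_mod_cast h1
      rw [h2] at hθ h0
      have h3 : |m| < 1 := by exact_mod_cast hθ
      exact h0 (by rw [Int.abs_lt_one_iff.1 h3]; simp)
  · have := sub_smul_dslope F 0 (θ : ℂ)
    simp only [F, sub_zero, smul_eq_mul, mul_zero, Complex.exp_zero] at this
    exact this.symm

end hadamard

/-! ### Uniqueness of the Dirac comb. -/

section combUnique

variable {n : ℕ}

/-- If `ψ` lies locally in the ideal generated by functions `G j` that annihilate `v`, then
`ψ v` vanishes locally. -/
theorem apply_smulLeftCLM_eq_zero_of_eq_sum {v : 𝓢'(En n, ℂ)} {G h : Fin n → En n → ℂ}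
    (hG : ∀ j, (G j).HasTemperateGrowth)
    (hv : ∀ j, TemperedDistribution.smulLeftCLM ℂ (G j) v = 0) {ψ : En n → ℂ}
    (hψ : ψ.HasTemperateGrowth) {U : Set (En n)} (hU : IsOpen U) (hUb : Bornology.IsBounded U)
    (hh : ∀ j, ContDiffOn ℝ (⊤ : ℕ∞) (h j) U) (hsum : ∀ y ∈ U, ψ y = ∑ j, G j y * h j y)
    (u : 𝓢(En n, ℂ)) (hu : tsupport u ⊆ U) : v (SchwartzMap.smulLeftCLM ℂ ψ u) = 0 := by
  have huc : HasCompactSupport u :=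
    Metric.isCompact_of_isClosed_isBounded (isClosed_tsupport u) (hUb.subset hu)
  -- Each `h j` is smooth on `U` only; multiplied by `u`, which is supported in the bounded set `U`,
  -- it becomes a test function.
  have hc : ∀ j, HasCompactSupport (h j * ⇑u) := fun j ↦ huc.mul_left
  have hs : ∀ j, ContDiff ℝ (⊤ : ℕ∞) (h j * ⇑u) := fun j ↦ by
    refine contDiff_iff_contDiffAt.2 fun x ↦ ?_
    by_cases hx : x ∈ tsupport (h j * ⇑u)
    swap
    · exact contDiffAt_const (c := (0 : ℂ)) |>.congr_of_eventuallyEq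
        (notMem_tsupport_iff_eventuallyEq.1 hx)
    have hxU : x ∈ U := hu (tsupport_mul_subset_right (f := h j) (g := u) hx)
    exact ((hh j).contDiffAt (hU.mem_nhds hxU)).mul (u.smooth ⊤).contDiffAt
  have key : SchwartzMap.smulLeftCLM ℂ ψ u =
      ∑ j, SchwartzMap.smulLeftCLM ℂ (G j) ((hc j).toSchwartzMap (hs j)) := by
    ext y
    rw [sum_apply, SchwartzMap.smulLeftCLM_apply_apply hψ]
    have : ∀ j, SchwartzMap.smulLeftCLM ℂ (G j) ((hc j).toSchwartzMap (hs j)) y =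
        G j y * h j y * u y := fun j ↦ by
      rw [SchwartzMap.smulLeftCLM_apply_apply (hG j), smul_eq_mul, mul_assoc]
      rfl
    rw [Finset.sum_congr rfl fun j _ ↦ this j, ← Finset.sum_mul, smul_eq_mul]
    by_cases hy : y ∈ tsupport u
    · rw [hsum y (hu hy)]
    · rw [image_eq_zero_of_notMem_tsupport hy, mul_zero, mul_zero]
  rw [key, map_sum]
  refine Finset.sum_eq_zero fun j _ ↦ ?_
  rw [← TemperedDistribution.smulLeftCLM_apply_apply, hv]
  rfl

variable (L : Submodule ℤ (En n)) [DiscreteTopology L] [IsZLattice ℝ L] (q : En n)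

open Distribution in
/-- A distribution on which the characters of the dual lattice act as on `δ_q` is annihilated by
every function that vanishes on `L + q`. -/
theorem smulLeftCLM_eq_zero_of_expMul_eq {v : 𝓢'(En n, ℂ)}
    (hv : ∀ ξ ∈ dualLattice L, expMul ξ v = planeWave ξ q • v) {ψ : En n → ℂ}
    (hψ : ψ.HasTemperateGrowth) (hψ0 : ∀ p ∈ L, ψ (p + q) = 0) :
    TemperedDistribution.smulLeftCLM ℂ ψ v = 0 := by
  obtain ⟨p, ξ, hB⟩ := exists_isDualBases L
  let G : Fin n → En n → ℂ := fun j x ↦ planeWave (ξ j) x - planeWave (ξ j) q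
  have hG : ∀ j, (G j).HasTemperateGrowth := fun j ↦
    (hasTemperateGrowth_planeWave _).sub (Function.HasTemperateGrowth.const _)
  have hGv : ∀ j, TemperedDistribution.smulLeftCLM ℂ (G j) v = 0 := fun j ↦ by
    have := TemperedDistribution.smulLeftCLM_sub (F := ℂ) (hasTemperateGrowth_planeWave (ξ j))
      (Function.HasTemperateGrowth.const (E := En n) (planeWave (ξ j) q))
    change TemperedDistribution.smulLeftCLM ℂ (planeWave (ξ j) - fun _ ↦ planeWave (ξ j) q) v = 0
    rw [this, sub_apply, TemperedDistribution.smulLeftCLM_const, ← expMul_eq_smulLeftCLM,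
      hv _ (hB.right_mem j), sub_self]
  have hempty : ∀ x, x ∉ dsupport (TemperedDistribution.smulLeftCLM ℂ ψ v) := by
    intro x
    rw [notMem_dsupport_iff]
    -- The common zero set of the `G j` is `L + q`. Off it some `G j` is locally invertible. Near a
    -- point `x` of it, `G j` is a unit times the dual coordinate `θ j`, with `|θ j| < 1` keeping
    -- the unit away from zero, and Hadamard's lemma writes `ψ` as a combination of the `θ j`.
    by_cases hx : ∃ j, G j x ≠ 0
    · obtain ⟨j, hj⟩ := hx
      refine ⟨{y | G j y ≠ 0} ∩ Metric.ball x 1, fun u hu ↦ ?_, ?_, hj, Metric.mem_ball_self one_pos⟩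
      · refine apply_smulLeftCLM_eq_zero_of_eq_sum (h := fun i y ↦ if i = j then ψ y / G j y else 0)
          hG hGv hψ ?_ (Metric.isBounded_ball.subset Set.inter_subset_right) (fun i ↦ ?_)
          (fun y hy ↦ ?_) u hu
        · exact ((hG j).1.continuous.isOpen_preimage _ isOpen_ne).inter Metric.isOpen_ball
        · by_cases hij : i = j
          · simp only [hij, if_true]
            simp only [div_eq_mul_inv]
            exact hψ.1.contDiffOn.mul ((hG j).1.contDiffOn.inv fun y hy ↦ hy.1)
          · simp only [hij, if_false]
            exact contDiffOn_const
        · simp only [mul_ite, mul_zero, Finset.sum_ite_eq', Finset.mem_univ, if_true]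
          rw [mul_div_cancel₀ _ hy.1]
      · exact ((hG j).1.continuous.isOpen_preimage _ isOpen_ne).inter Metric.isOpen_ball
    · push Not at hx
      have hxq : x - q ∈ L := by
        refine (hB.mem_iff _).2 fun j ↦ planeWave_eq_one_iff.1 ?_
        rw [planeWave_sub_right, sub_eq_zero.1 (hx j), mul_inv_cancel₀ (planeWave_ne_zero _ _)]
      have hψx : ψ x = 0 := by simpa using hψ0 _ hxq
      obtain ⟨h, hh, hhe⟩ := exists_contDiff_sub_eq_apply hψ.1 x
      obtain ⟨k, hk, hk0, hke⟩ := exists_contDiff_cexp_sub_one_eq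
      let θ : Fin n → En n → ℝ := fun j y ↦ inner ℝ (ξ j) (y - x)
      have hθ : ∀ j, ContDiff ℝ (⊤ : ℕ∞) (θ j) := fun j ↦
        contDiff_const.inner ℝ (contDiff_id.sub contDiff_const)
      have hUo : IsOpen ((⋂ j, {y | |θ j y| < 1}) ∩ Metric.ball x 1) := by
        refine (isOpen_iInter_of_finite fun j ↦ ?_).inter Metric.isOpen_ball
        exact isOpen_lt (hθ j).continuous.abs continuous_const
      refine ⟨(⋂ j, {y | |θ j y| < 1}) ∩ Metric.ball x 1, fun u hu ↦ ?_, hUo, ?_,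
        Metric.mem_ball_self one_pos⟩
      · refine apply_smulLeftCLM_eq_zero_of_eq_sum
          (h := fun j y ↦ h y (p j) / (planeWave (ξ j) q * k (θ j y)))
          hG hGv hψ hUo (Metric.isBounded_ball.subset Set.inter_subset_right) (fun j ↦ ?_)
          (fun y hy ↦ ?_) u hu
        · simp only [div_eq_mul_inv]
          refine (hh.clm_apply contDiff_const).contDiffOn.mul
            ((contDiff_const.mul (hk.comp (hθ j))).contDiffOn.inv fun y hy ↦ ?_)
          exact mul_ne_zero (planeWave_ne_zero _ _) (hk0 _ (Set.mem_iInter.1 hy.1 j))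
        · have h1 : ψ y = h y (y - x) := by rw [← hhe, hψx, sub_zero]
          rw [h1]
          conv_lhs => rw [hB.sum_left (y - x), map_sum]
          refine Finset.sum_congr rfl fun j _ ↦ ?_
          have hkj : k (θ j y) ≠ 0 := hk0 _ (Set.mem_iInter.1 hy.1 j)
          have hGj : G j y = planeWave (ξ j) q * ((θ j y : ℝ) * k (θ j y)) := by
            rw [← hke, mul_sub, mul_one]
            simp only [G]
            congr 1
            have h2 := sub_eq_zero.1 (hx j)
            rw [← h2]
            change _ = _ * planeWave (ξ j) (y - x)
            rw [← planeWave_add_right]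
            congr 1
            abel
          have hpw := planeWave_ne_zero (ξ j) q
          rw [map_smul, hGj, Complex.real_smul]
          field_simp
          exact mul_comm _ _
      · simp [θ]
  have hv' := (TemperedDistribution.smulLeftCLM ℂ ψ v).isVanishingOn_compl_dsupport
  ext φ
  exact hv' φ fun x _ ↦ hempty x

/-- The test function and the cutoff exchange roles: `v(χψ) = (ψv)(χ)`, and `ψ` is itself a
multiplier vanishing on `L + q`. -/
theorem apply_eq_zero_of_expMul_eq {v : 𝓢'(En n, ℂ)}
    (hv : ∀ ξ ∈ dualLattice L, expMul ξ v = planeWave ξ q • v) (ψ : 𝓢(En n, ℂ))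
    (hψ0 : ∀ p ∈ L, ψ (p + q) = 0) : v ψ = 0 := by
  refine v.apply_eq_zero_of_compactSupport ψ fun χ hχ hχt ↦ ?_
  have h := smulLeftCLM_eq_zero_of_expMul_eq L q hv ψ.hasTemperateGrowth hψ0
  have h2 := DFunLike.congr_fun h (hχ.toSchwartzMap hχt.1)
  rw [TemperedDistribution.smulLeftCLM_apply_apply] at h2
  refine Eq.trans (congrArg v ?_) h2
  ext x
  rw [SchwartzMap.smulLeftCLM_apply_apply hχt,
    SchwartzMap.smulLeftCLM_apply_apply ψ.hasTemperateGrowth, smul_eq_mul, smul_eq_mul, mul_comm]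
  rfl

theorem exists_pos_forall_norm_lt (L : Submodule ℤ (En n)) [DiscreteTopology L] :
    ∃ ε > 0, ∀ p ∈ L, ‖p‖ < ε → p = 0 := by
  obtain ⟨ε, hε, h⟩ := Metric.exists_ball_inter_eq_singleton_of_mem_discrete
    (s := (L : Set (En n))) (isDiscrete_iff_discreteTopology.2 inferInstance) L.zero_mem
  refine ⟨ε, hε, fun p hp hpε ↦ ?_⟩
  have : p ∈ Metric.ball 0 ε ∩ (L : Set (En n)) := ⟨by simpa using hpε, hp⟩
  rw [h] at this
  exact this

/-- The Dirac comb is characterised, up to a constant, by its invariance properties. -/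
theorem exists_eq_smul_comb {v : 𝓢'(En n, ℂ)}
    (hv : ∀ ξ ∈ dualLattice L, expMul ξ v = planeWave ξ q • v)
    (hv' : ∀ p ∈ L, shiftBy p v = v) : ∃ c : ℂ, v = c • comb L q := by
  classical
  obtain ⟨ε, hε, hLε⟩ := exists_pos_forall_norm_lt L
  -- Distinct points of `L + q` are at distance at least `ε`, so this bump sees `q` alone and the
  -- constant must be `v B`.
  let b : ContDiffBump q := ⟨ε / 2, ε, by positivity, by linarith⟩
  have hbs : ContDiff ℝ (⊤ : ℕ∞) (fun x ↦ ((b x : ℝ) : ℂ)) :=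
    Complex.ofRealCLM.contDiff.comp b.contDiff
  have hbc : HasCompactSupport (fun x ↦ ((b x : ℝ) : ℂ)) :=
    b.hasCompactSupport.comp_left (g := Complex.ofReal) rfl
  let B : 𝓢(En n, ℂ) := hbc.toSchwartzMap hbs
  have hB1 : B q = 1 := by
    change ((b q : ℝ) : ℂ) = 1
    rw [b.one_of_mem_closedBall (Metric.mem_closedBall_self b.rIn_pos.le)]
    simp
  have hB0 : ∀ p ∈ L, p ≠ 0 → B (p + q) = 0 := fun p hp hp0 ↦ by
    change ((b (p + q) : ℝ) : ℂ) = 0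
    rw [b.zero_of_le_dist, Complex.ofReal_zero]
    rw [dist_eq_norm, add_sub_cancel_right]
    exact not_lt.1 fun h ↦ hp0 (hLε p hp h)
  refine ⟨v B, ?_⟩
  rw [← sub_eq_zero]
  ext φ
  refine TemperedDistribution.apply_eq_zero_of_compactSupport _ φ fun χ hχ hχt ↦ ?_
  set φ' := SchwartzMap.smulLeftCLM ℂ χ φ with hφ'
  have hφ'c : ∀ x, x ∉ tsupport χ → φ' x = 0 := fun x hx ↦ by
    rw [hφ', SchwartzMap.smulLeftCLM_apply_apply hχt, image_eq_zero_of_notMem_tsupport hx, zero_smul]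
  have hfin : Set.Finite {p : L | (p : En n) + q ∈ tsupport χ} := by
    have hcl : IsClosed (L : Set (En n)) :=
      @AddSubgroup.isClosed_of_discrete _ _ _ _ _ L.toAddSubgroup
        (inferInstanceAs (DiscreteTopology L))
    have hK : IsCompact ((fun x : En n ↦ x + q) ⁻¹' tsupport χ) :=
      (Homeomorph.addRight q).isCompact_preimage.2 hχ
    have := Metric.finite_isBounded_inter_isClosed
      (isDiscrete_iff_discreteTopology.2 (inferInstanceAs (DiscreteTopology L)))
      hK.isBounded hcl
    exact (this.preimage Subtype.val_injective.injOn).subset fun p hp ↦ ⟨hp, p.2⟩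
  let F : Finset L := hfin.toFinset
  have hF : ∀ p : L, p ∉ F → φ' (p + q) = 0 := fun p hp ↦
    hφ'c _ fun h ↦ hp (hfin.mem_toFinset.2 h)
  -- Subtracting the interpolation of `φ'` by translates of `B` leaves a function that vanishes on
  -- `L + q`. Thus `v` depends only on the values of `φ'` there, and shift invariance makes all
  -- weights equal to `v B`.
  let ψ : 𝓢(En n, ℂ) := φ' - ∑ p ∈ F, φ' (p + q) • SchwartzMap.compSubConstCLM ℂ (p : En n) B
  have hψ : v ψ = 0 := by
    refine apply_eq_zero_of_expMul_eq L q hv ψ fun p hp ↦ ?_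
    have h1 : ∀ p' : L, (φ' (p' + q) • SchwartzMap.compSubConstCLM ℂ (p' : En n) B) (p + q) =
        if p' = ⟨p, hp⟩ then φ' (p + q) else 0 := fun p' ↦ by
      rw [smul_apply, SchwartzMap.compSubConstCLM_apply, add_sub_right_comm]
      split_ifs with h
      · subst h
        rw [sub_self, zero_add, hB1, smul_eq_mul, mul_one]
      · rw [hB0 _ (L.sub_mem hp p'.2) fun h0 ↦ h (Subtype.ext (sub_eq_zero.1 h0).symm), smul_zero]
    rw [sub_apply, sum_apply, Finset.sum_congr rfl fun p' _ ↦ h1 p', Finset.sum_ite_eq']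
    split_ifs with h
    · rw [sub_self]
    · rw [hF ⟨p, hp⟩ h, sub_zero]
  have hshift : ∀ p : L, v (SchwartzMap.compSubConstCLM ℂ (p : En n) B) = v B := fun p ↦ by
    have h1 := DFunLike.congr_fun (hv' _ (L.neg_mem p.2)) B
    rwa [shiftBy_apply_apply, neg_neg] at h1
  have hvφ : v φ' = ∑ p ∈ F, φ' (p + q) * v B := by
    have : v ψ = v φ' - ∑ p ∈ F, φ' (p + q) * v B := by
      rw [map_sub, map_sum]
      congr 1
      refine Finset.sum_congr rfl fun p _ ↦ ?_
      rw [map_smul, hshift, smul_eq_mul]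
    rw [hψ] at this
    exact (sub_eq_zero.1 this.symm)
  change v φ' - v B • comb L q φ' = 0
  rw [comb_apply, tsum_eq_sum (s := F) fun p hp ↦ hF p hp, hvφ, ← Finset.sum_mul, smul_eq_mul,
    mul_comm, sub_self]

end combUnique

/-! ### Poisson summation for a lattice. -/

section poisson

variable {n : ℕ} (L : Submodule ℤ (En n)) [DiscreteTopology L]

theorem expMul_comb {ξ : En n} (hξ : ξ ∈ dualLattice L) (q : En n) :
    expMul ξ (comb L q) = planeWave ξ q • comb L q := by
  ext φ
  rw [expMul_apply_apply, smul_apply, comb_apply, comb_apply, smul_eq_mul, ← tsum_mul_left]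
  refine tsum_congr fun p ↦ ?_
  rw [SchwartzMap.smulLeftCLM_apply_apply (hasTemperateGrowth_planeWave ξ), planeWave_add_right,
    planeWave_eq_one_of_mem hξ p.2, one_mul, smul_eq_mul]

theorem shiftBy_comb {p : En n} (hp : p ∈ L) (q : En n) : shiftBy p (comb L q) = comb L q := by
  ext φ
  rw [shiftBy_apply_apply, comb_apply, comb_apply,
    ← (Equiv.addRight (⟨p, hp⟩ : L)).tsum_eq fun x : L ↦ φ (x + q)]
  refine tsum_congr fun x ↦ ?_
  rw [SchwartzMap.compSubConstCLM_apply]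
  congr 1
  simp only [Equiv.coe_addRight, Submodule.coe_add]
  abel

theorem shiftBy_comb_zero (q : En n) : shiftBy q (comb L 0) = comb L q := by
  ext φ
  rw [shiftBy_apply_apply, comb_apply, comb_apply]
  refine tsum_congr fun x ↦ ?_
  rw [SchwartzMap.compSubConstCLM_apply]
  congr 1
  abel

open MeasureTheory in
-- Unfolding: the translates of `F` tile the space, and `y ↦ comb L y φ` is the periodisation of
-- `φ`.
theorem setIntegral_comb [IsZLattice ℝ L] (φ : 𝓢(En n, ℂ)) {F : Set (En n)}
    (hF : IsAddFundamentalDomain L F volume) :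
    ∫ y in F, comb L y φ = ∫ y, φ y := by
  have : Countable L := inferInstance
  have : MeasurableVAdd L (En n) := (inferInstance : MeasurableVAdd L.toAddSubgroup (En n))
  have : VAddInvariantMeasure L (En n) volume :=
    (inferInstance : VAddInvariantMeasure L.toAddSubgroup (En n) volume)
  rw [hF.integral_eq_tsum'' φ φ.integrable, ← integral_tsum]
  · rfl
  · intro p
    exact (φ.continuous.comp (continuous_const_vadd p)).aestronglyMeasurable
  · rw [← hF.lintegral_eq_tsum'' fun y ↦ ‖φ y‖ₑ]
    exact φ.integrable.hasFiniteIntegral.ne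

open MeasureTheory in
/-- The Poisson summation formula for a lattice. -/
theorem fourier_comb_zero [IsZLattice ℝ L] :
    𝓕 (comb L 0) = (((ZLattice.covolume L)⁻¹ : ℝ) : ℂ) • comb (dualLattice L) 0 := by
  -- The Fourier transform exchanges the two invariances of the comb, so uniqueness applies to the
  -- dual lattice and only the constant remains.
  obtain ⟨c, hc⟩ := exists_eq_smul_comb (dualLattice L) 0 (v := 𝓕 (comb L 0))
    (fun p hp ↦ by
      rw [dualLattice_dualLattice] at hp
      have h := fourier_shiftBy (-p) (comb L 0)
      rw [shiftBy_comb L (L.neg_mem hp), neg_neg] at h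
      rw [← h, planeWave_zero_right, one_smul])
    (fun ξ hξ ↦ by
      rw [← fourier_expMul, expMul_comb L hξ, planeWave_zero_right, one_smul])
  have hcomb : ∀ y, 𝓕 (comb L y) = c • expMul (-y) (comb (dualLattice L) 0) := fun y ↦ by
    rw [← shiftBy_comb_zero, fourier_shiftBy, hc, map_smul]
  obtain ⟨ε, hε, hLε⟩ := exists_pos_forall_norm_lt (dualLattice L)
  let b : ContDiffBump (0 : En n) := ⟨ε / 2, ε, by positivity, by linarith⟩
  have hbs : ContDiff ℝ (⊤ : ℕ∞) (fun x ↦ ((b x : ℝ) : ℂ)) :=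
    Complex.ofRealCLM.contDiff.comp b.contDiff
  have hbc : HasCompactSupport (fun x ↦ ((b x : ℝ) : ℂ)) :=
    b.hasCompactSupport.comp_left (g := Complex.ofReal) rfl
  let B : 𝓢(En n, ℂ) := hbc.toSchwartzMap hbs
  have hB1 : B 0 = 1 := by
    change ((b 0 : ℝ) : ℂ) = 1
    rw [b.one_of_mem_closedBall (Metric.mem_closedBall_self b.rIn_pos.le)]
    simp
  have hB0 : ∀ ξ ∈ dualLattice L, ξ ≠ 0 → B ξ = 0 := fun ξ hξ hξ0 ↦ by
    change ((b ξ : ℝ) : ℂ) = 0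
    rw [b.zero_of_le_dist, Complex.ofReal_zero]
    rw [dist_zero_right]
    exact not_lt.1 fun h ↦ hξ0 (hLε ξ hξ h)
  -- `B` sees only the point 0 of the dual lattice, so the periodisation of `𝓕 B` is the constant
  -- `c`. Integration over a fundamental domain gives `c · covol(L) = ∫ 𝓕 B = B 0 = 1`.
  have hconst : ∀ y, comb L y (𝓕 B) = c := fun y ↦ by
    have h1 := DFunLike.congr_fun (hcomb y) B
    rw [TemperedDistribution.fourier_apply, smul_apply, expMul_apply_apply,
      comb_apply (dualLattice L), tsum_eq_single (0 : dualLattice L)] at h1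
    · rw [h1, SchwartzMap.smulLeftCLM_apply_apply (hasTemperateGrowth_planeWave _)]
      simp [hB1]
    · intro ξ hξ
      rw [SchwartzMap.smulLeftCLM_apply_apply (hasTemperateGrowth_planeWave _), add_zero,
        hB0 ξ ξ.2 (by simpa using hξ), smul_zero]
  have : Module.Finite ℤ L := ZLattice.module_finite ℝ L
  have : Module.Free ℤ L := ZLattice.module_free ℝ L
  have hF := ZLattice.isAddFundamentalDomain (Module.Free.chooseBasis ℤ L)
    (volume : Measure (En n))
  have h2 := setIntegral_comb L (𝓕 B) hF
  simp only [hconst] at h2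
  have h3 : ∫ y, (𝓕 B) y = 1 := by
    have h4 : 𝓕⁻ (𝓕 B) = B := FourierTransform.fourierInv_fourier_eq B
    have h5 := DFunLike.congr_fun h4 0
    rw [hB1, SchwartzMap.fourierInv_coe, Real.fourierInv_eq] at h5
    rw [← h5]
    simp
  rw [setIntegral_const, h3, ← ZLattice.covolume_eq_measure_fundamentalDomain L volume hF] at h2
  have hcov := ZLattice.covolume_ne_zero L (volume : Measure (En n))
  have hc' : c = (((ZLattice.covolume L)⁻¹ : ℝ) : ℂ) := by
    rw [Complex.real_smul] at h2
    rw [Complex.ofReal_inv]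
    exact eq_inv_of_mul_eq_one_right h2
  rw [hc, hc']

theorem fourier_comb [IsZLattice ℝ L] (q : En n) :
    𝓕 (comb L q) =
      (((ZLattice.covolume L)⁻¹ : ℝ) : ℂ) • expMul (-q) (comb (dualLattice L) 0) := by
  rw [← shiftBy_comb_zero, fourier_shiftBy, fourier_comb_zero, map_smul]

end poisson

/-! ### Generalised eigenvectors of commuting operators. -/

theorem Commute.sub_algebraMap_pow {R : Type*} [Ring R] [Algebra ℂ R] {a b : R} (h : Commute a b) (μ : ℂ) (N : ℕ) :
    Commute a ((b - algebraMap ℂ R μ) ^ N) :=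
  (h.sub_right (Algebra.commutes μ a).symm).pow_right N

open Polynomial in
-- Bézout for the coprime polynomials `(X - μ) ^ m` and `(X - c) ^ N`.
theorem eq_zero_of_pow_smul_eq_zero {R M : Type*} [Ring R] [Algebra ℂ R] [AddCommGroup M]
    [Module R M] {a : R} {μ c : ℂ} (h : μ ≠ c) {m N : ℕ} {v : M}
    (h1 : (a - algebraMap ℂ R μ) ^ m • v = 0) (h2 : (a - algebraMap ℂ R c) ^ N • v = 0) :
    v = 0 := by
  have hc : IsCoprime ((X - C μ) ^ m : ℂ[X]) ((X - C c) ^ N) :=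
    (isCoprime_X_sub_C_of_isUnit_sub (sub_ne_zero.2 h).isUnit).pow
  obtain ⟨α, β, hαβ⟩ := hc
  have h3 : v = aeval a (α * (X - C μ) ^ m) • v + aeval a (β * (X - C c) ^ N) • v := by
    rw [← add_smul, ← map_add, hαβ, map_one, one_smul]
  rw [h3, map_mul, map_mul, mul_smul, mul_smul]
  simp [h1, h2]

/-- A generalised simultaneous eigenvector that is annihilated by sufficiently many products of
the operators `A j - c i j` has eigenvalues `c i` for some `i`. -/
theorem exists_forall_eigenvalue_eq {R M I J : Type*} [Ring R] [Algebra ℂ R] [AddCommGroup M]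
    [Module R M] {A : J → R} (hA : ∀ j k, Commute (A j) (A k))
    {c : I → J → ℂ} {N : ℕ} {μ : J → ℂ} {m : J → ℕ} {u : M} (hu : u ≠ 0)
    (hμ : ∀ j, (A j - algebraMap ℂ R (μ j)) ^ m j • u = 0) (l : List I)
    (hl : ∀ σ : I → J,
      (l.map fun i ↦ (A (σ i) - algebraMap ℂ R (c i (σ i))) ^ N).prod • u = 0) :
    ∃ i, ∀ j, μ j = c i j := by
  by_contra! hne
  -- If `μ` differs from every `c i`, let `σ i` be a coordinate where it does. Each factor of the
  -- product for this `σ` is injective on the generalised eigenvectors with eigenvalues `μ`, which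
  -- forces `u = 0`; hence the hypothesis for all choice functions.
  choose σ hσ using hne
  have key : ∀ l' : List I, (∀ i ∈ l', μ (σ i) ≠ c i (σ i)) →
      (l'.map fun i ↦ (A (σ i) - algebraMap ℂ R (c i (σ i))) ^ N).prod • u = 0 → u = 0 := by
    intro l'
    induction l' with
    | nil => intro _ h; simpa using h
    | cons i l' ih =>
      intro h h0
      refine ih (fun k hk ↦ h k (by simp [hk])) ?_
      rw [List.map_cons, List.prod_cons, mul_smul] at h0
      refine eq_zero_of_pow_smul_eq_zero (h i (by simp)) (m := m (σ i)) ?_ h0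
      rw [← mul_smul]
      have hcomm : Commute ((A (σ i) - algebraMap ℂ R (μ (σ i))) ^ m (σ i))
          (l'.map fun i ↦ (A (σ i) - algebraMap ℂ R (c i (σ i))) ^ N).prod := by
        refine Commute.list_prod_right _ _ fun x hx ↦ ?_
        obtain ⟨k, -, rfl⟩ := List.mem_map.1 hx
        refine Commute.sub_algebraMap_pow ?_ _ _
        exact ((hA (σ k) (σ i)).sub_algebraMap_pow _ _).symm
      rw [hcomm.eq, mul_smul, hμ, smul_zero]
  exact hu (key l (fun i _ ↦ hσ i) (hl σ))

section genEigen

open Polynomial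

variable {R M : Type*} [Ring R] [Algebra ℂ R] [AddCommGroup M] [Module ℂ M] [Module R M]
  [IsScalarTower ℂ R M]

theorem aeval_smul_mem_of_smul_mem {a : R} {Q : Submodule ℂ M} (hQ : ∀ u ∈ Q, a • u ∈ Q)
    (f : ℂ[X]) {u : M} (hu : u ∈ Q) : aeval a f • u ∈ Q := by
  induction f using Polynomial.induction_on' with
  | add p q hp hq =>
    rw [map_add, add_smul]
    exact Q.add_mem hp hq
  | monomial k c =>
    rw [aeval_monomial, ← Algebra.smul_def, smul_assoc]
    refine Q.smul_mem c ?_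
    induction k with
    | zero => simpa using hu
    | succ k ih =>
      rw [pow_succ', mul_smul]
      exact hQ _ ih

/-- A vector annihilated by a nonzero polynomial in `a` is a sum of generalised eigenvectors. -/
theorem mem_span_genEigenvector {a : R} {Q : Submodule ℂ M} (hQ : ∀ u ∈ Q, a • u ∈ Q)
    {f : ℂ[X]} (hf : f ≠ 0) {u : M} (hu : u ∈ Q) (hfu : aeval a f • u = 0) :
    u ∈ Submodule.span ℂ {w | w ∈ Q ∧ ∃ (μ : ℂ) (N : ℕ), (a - algebraMap ℂ R μ) ^ N • w = 0} := by
  induction f using UniqueFactorizationMonoid.induction_on_coprime generalizing u with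
  | h0 => exact absurd rfl hf
  | @h1 g hg =>
    obtain ⟨r, hr, rfl⟩ := Polynomial.isUnit_iff.1 hg
    rw [aeval_C, algebraMap_smul] at hfu
    rw [(smul_eq_zero.1 hfu).resolve_left hr.ne_zero]
    exact Submodule.zero_mem _
  | @hpr p i hp =>
    have hdeg := IsAlgClosed.degree_eq_one_of_irreducible ℂ hp.irreducible
    obtain ⟨b, hb, c, hpc⟩ : ∃ b : ℂ, b ≠ 0 ∧ ∃ c, p = C b * (X - C c) := by
      have h1 := eq_X_add_C_of_degree_eq_one hdeg
      have h2 : p.leadingCoeff ≠ 0 := leadingCoeff_ne_zero.2 hp.ne_zero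
      refine ⟨p.leadingCoeff, h2, -(p.coeff 0 / p.leadingCoeff), ?_⟩
      conv_lhs => rw [h1]
      rw [mul_sub, ← C_mul, mul_neg, mul_div_cancel₀ _ h2, C_neg, sub_neg_eq_add]
    refine Submodule.subset_span ⟨hu, c, i, ?_⟩
    rw [hpc, mul_pow, ← C_pow, map_mul, aeval_C, mul_smul, algebraMap_smul] at hfu
    have h3 := (smul_eq_zero.1 hfu).resolve_left (pow_ne_zero i hb)
    simpa using h3
  | @hcp x y hxy hx hy =>
    have hx0 : x ≠ 0 := left_ne_zero_of_mul hf
    have hy0 : y ≠ 0 := right_ne_zero_of_mul hf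
    obtain ⟨α, β, hαβ⟩ := EuclideanDomain.isCoprime_of_dvd (x := x) (y := y) (fun h ↦ hx0 h.1)
      fun z hz _ h1 h2 ↦ hz (hxy h1 h2)
    have h4 : u = aeval a (α * x) • u + aeval a (β * y) • u := by
      rw [← add_smul, ← map_add, hαβ, map_one, one_smul]
    rw [h4]
    refine Submodule.add_mem _ (hy hy0 (aeval_smul_mem_of_smul_mem hQ _ hu) ?_)
      (hx hx0 (aeval_smul_mem_of_smul_mem hQ _ hu) ?_)
    · rw [← mul_smul, ← map_mul, show y * (α * x) = α * (x * y) by ring, map_mul, mul_smul, hfu,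
        smul_zero]
    · rw [← mul_smul, ← map_mul, show x * (β * y) = β * (x * y) by ring, map_mul, mul_smul, hfu,
        smul_zero]

/-- The submodule of all `w ∈ Q` with `B j • w = 0` for `j ∈ s`. -/
def Submodule.annihilatedBy {J : Type*} (Q : Submodule ℂ M) (s : Finset J) (B : J → R) :
    Submodule ℂ M where
  carrier := {w | w ∈ Q ∧ ∀ j ∈ s, B j • w = 0}
  add_mem' ha hb := ⟨Q.add_mem ha.1 hb.1, fun j hj ↦ by
    rw [smul_add, ha.2 j hj, hb.2 j hj, add_zero]⟩
  zero_mem' := ⟨Q.zero_mem, fun j _ ↦ smul_zero _⟩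
  smul_mem' c w hw := ⟨Q.smul_mem c hw.1, fun j hj ↦ by
    rw [← algebraMap_smul R c w, ← mul_smul, ← Algebra.commutes, mul_smul, hw.2 j hj, smul_zero]⟩

theorem Submodule.smul_mem_annihilatedBy {J : Type*} {Q : Submodule ℂ M} {s : Finset J} {B : J → R}
    {a : R} (hQ : ∀ u ∈ Q, a • u ∈ Q) (hB : ∀ j ∈ s, Commute a (B j)) :
    ∀ u ∈ Q.annihilatedBy s B, a • u ∈ Q.annihilatedBy s B := fun u hu ↦
  ⟨hQ u hu.1, fun j hj ↦ by rw [← mul_smul, ← (hB j hj).eq, mul_smul, hu.2 j hj, smul_zero]⟩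

/-- Simultaneous decomposition into generalised eigenvectors for commuting operators. -/
theorem mem_span_simultaneous {J : Type*} {A : J → R} (hA : ∀ j k, Commute (A j) (A k))
    (s : Finset J) {Q : Submodule ℂ M} (hQ : ∀ j, ∀ u ∈ Q, A j • u ∈ Q)
    (hf : ∀ j, ∃ f : ℂ[X], f ≠ 0 ∧ ∀ u ∈ Q, aeval (A j) f • u = 0) {u : M} (hu : u ∈ Q) :
    u ∈ Submodule.span ℂ {w | w ∈ Q ∧
      ∀ j ∈ s, ∃ (μ : ℂ) (N : ℕ), (A j - algebraMap ℂ R μ) ^ N • w = 0} := by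
  classical
  induction s using Finset.induction_on with
  | empty => exact Submodule.subset_span ⟨hu, by simp⟩
  | insert j s hj ih =>
    refine Submodule.span_le.2 ?_ ih
    rintro w ⟨hw, hws⟩
    choose! μ N hμ using hws
    -- Splitting along `A j` inside `Q'` preserves the eigenvalue conditions already obtained for
    -- `s`, because `A j` commutes with them.
    let Q' := Q.annihilatedBy s fun k ↦ (A k - algebraMap ℂ R (μ k)) ^ N k
    have hQ' : ∀ u ∈ Q', A j • u ∈ Q' := Submodule.smul_mem_annihilatedBy (hQ j) fun k _ ↦
      (hA j k).sub_algebraMap_pow _ _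
    obtain ⟨f, hf0, hfQ⟩ := hf j
    refine Submodule.span_mono ?_
      (mem_span_genEigenvector hQ' hf0 (u := w) ⟨hw, hμ⟩ (hfQ w hw))
    rintro v ⟨hv, hvj⟩
    refine ⟨hv.1, fun k hk ↦ ?_⟩
    rcases Finset.mem_insert.1 hk with rfl | hk
    · exact hvj
    · exact ⟨μ k, N k, hv.2 k hk⟩

end genEigen

/-! ### From eigenvectors to generalised eigenvectors. -/

section newton

variable {R M : Type*} [Ring R] [Algebra ℂ R] [AddCommGroup M] [Module ℂ M] [Module R M]
  [IsScalarTower ℂ R M]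

/-- A generalised eigenvector of `T` is obtained from eigenvectors by means of an operator `X` with
`T X = (X + c) T`. -/
theorem mem_of_genEigenvector {T X : R} {c μ : ℂ} (hc : c ≠ 0) (hμ : μ ≠ 0)
    (hTX : T * X = (X + algebraMap ℂ R c) * T) {Q W : Submodule ℂ M}
    (hQT : ∀ u ∈ Q, T • u ∈ Q) (hQX : ∀ u ∈ Q, X • u ∈ Q) (hW : ∀ u ∈ W, X • u ∈ W)
    (hbase : ∀ u ∈ Q, T • u = μ • u → u ∈ W) (N : ℕ) :
    ∀ u ∈ Q, (T - algebraMap ℂ R μ) ^ N • u = 0 → u ∈ W := by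
  set Δ := T - algebraMap ℂ R μ with hΔ
  have hΔs : ∀ w : M, Δ • w = T • w - μ • w := fun w ↦ by rw [hΔ, sub_smul, algebraMap_smul]
  have hsm : ∀ (r : R) (z : ℂ) (w : M), r • (z • w) = z • (r • w) := fun r z w ↦ by
    rw [← algebraMap_smul R z w, ← mul_smul, ← Algebra.commutes, mul_smul, algebraMap_smul]
  induction N with
  | zero =>
    intro u _ h
    rw [pow_zero, one_smul] at h
    rw [h]
    exact W.zero_mem
  | succ N ih =>
    intro u hu h
    set w := Δ ^ N • u with hw
    have hQΔ : ∀ u ∈ Q, Δ • u ∈ Q := fun u hu ↦ by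
      rw [hΔs]
      exact Q.sub_mem (hQT u hu) (Q.smul_mem _ hu)
    have hwQ : w ∈ Q := by
      have : ∀ k : ℕ, Δ ^ k • u ∈ Q := fun k ↦ by
        induction k with
        | zero => simpa using hu
        | succ k ihk =>
          rw [pow_succ', mul_smul]
          exact hQΔ _ ihk
      exact this N
    have hwT : T • w = μ • w := by
      rw [← sub_eq_zero, ← hΔs, hw, ← mul_smul, ← pow_succ', h]
    -- Newton's basis: `y k = X(X - c)⋯(X - (k-1)c) w`. Since `T f(X) = f(X + c) T` and `T w = μ w`,
    -- `Δ` acts on such vectors through a forward difference and sends `y (k + 1)` to `μ c (k + 1) y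
    -- k`. So a multiple of `y N` has the same image under `Δ ^ N` as `u`, and subtracting it lowers
    -- the order.
    let y : ℕ → M := fun k ↦ Nat.rec w (fun k v ↦ X • v - ((k : ℂ) * c) • v) k
    have hy0 : y 0 = w := rfl
    have hys : ∀ k, y (k + 1) = X • y k - ((k : ℂ) * c) • y k := fun k ↦ rfl
    have hyQ : ∀ k, y k ∈ Q := fun k ↦ by
      induction k with
      | zero => exact hwQ
      | succ k ihk => exact Q.sub_mem (hQX _ ihk) (Q.smul_mem _ ihk)
    have hyW : ∀ k, y k ∈ W := fun k ↦ by
      induction k with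
      | zero => exact hbase w hwQ hwT
      | succ k ihk => exact W.sub_mem (hW _ ihk) (W.smul_mem _ ihk)
    have hTXs : ∀ v : M, T • X • v = X • T • v + c • T • v := fun v ↦ by
      rw [← mul_smul, hTX, mul_smul, add_smul, algebraMap_smul]
    have hyT : ∀ k, T • y (k + 1) = μ • (X • y k + c • y k) := fun k ↦ by
      induction k with
      | zero => rw [hys, hy0, Nat.cast_zero, zero_mul, zero_smul, sub_zero, hTXs, hwT, hsm, smul_add,
          smul_comm μ c]
      | succ k ihk =>
        rw [hys (k + 1), smul_sub, hTXs, hsm T, ihk]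
        rw [hys k]
        simp only [smul_add, smul_sub, hsm]
        generalize X • X • y k = z₁
        generalize X • y k = z₂
        generalize y k = z₃
        push_cast
        clear * -
        module
    have hyΔ : ∀ k : ℕ, Δ • y (k + 1) = (μ * c * (k + 1 : ℕ)) • y k := fun k ↦ by
      rw [hΔs, hyT, hys]
      generalize X • y k = z₂
      generalize y k = z₃
      push_cast
      clear * -
      module
    have hyΔN : ∀ k : ℕ, Δ ^ k • y k = ((μ * c) ^ k * (k.factorial : ℂ)) • w := fun k ↦ by
      induction k with
      | zero => simp [hy0]
      | succ k ihk =>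
        rw [pow_succ, mul_smul, hyΔ, hsm, ihk, smul_smul, Nat.factorial_succ]
        congr 1
        push_cast
        ring
    set κ : ℂ := (μ * c) ^ N * (N.factorial : ℂ) with hκ
    have hκ0 : κ ≠ 0 := mul_ne_zero (pow_ne_zero _ (mul_ne_zero hμ hc))
      (Nat.cast_ne_zero.2 N.factorial_ne_zero)
    have h1 : u - κ⁻¹ • y N ∈ W := by
      refine ih _ (Q.sub_mem hu (Q.smul_mem _ (hyQ N))) ?_
      rw [smul_sub, hsm, hyΔN, smul_smul, inv_mul_cancel₀ hκ0, one_smul, ← hw, sub_self]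
    have h2 := W.add_mem h1 (W.smul_mem κ⁻¹ (hyW N))
    rwa [sub_add_cancel] at h2

/-- Several-variable version of `mem_of_genEigenvector`. -/
theorem mem_of_forall_genEigenvector {ι : Type*} {T X : ι → R} {c μ : ι → ℂ} (hc : ∀ j, c j ≠ 0)
    (hμ : ∀ j, μ j ≠ 0) (hTX : ∀ j, T j * X j = (X j + algebraMap ℂ R (c j)) * T j)
    (hTX' : ∀ j k, j ≠ k → Commute (T j) (X k)) (hTT : ∀ j k, Commute (T j) (T k))
    {W : Submodule ℂ M} (hW : ∀ j, ∀ u ∈ W, X j • u ∈ W) (N : ι → ℕ) (s : Finset ι) :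
    ∀ Q : Submodule ℂ M, (∀ j ∈ s, ∀ u ∈ Q, T j • u ∈ Q) → (∀ j ∈ s, ∀ u ∈ Q, X j • u ∈ Q) →
      (∀ u ∈ Q, (∀ j ∈ s, T j • u = μ j • u) → u ∈ W) →
      ∀ u ∈ Q, (∀ j ∈ s, (T j - algebraMap ℂ R (μ j)) ^ N j • u = 0) → u ∈ W := by
  classical
  induction s using Finset.induction_on with
  | empty => exact fun Q _ _ h u hu _ ↦ h u hu (by simp)
  | insert j s hj ih =>
    intro Q hQT hQX hbase u hu hN
    have hne : ∀ k ∈ s, k ≠ j := fun k hk h ↦ hj (h ▸ hk)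
    let Q' := Q.annihilatedBy s fun k ↦ (T k - algebraMap ℂ R (μ k)) ^ N k
    refine mem_of_genEigenvector (hc j) (hμ j) (hTX j) (Q := Q') (W := W) ?_ ?_ (hW j) ?_ (N j) u
      ⟨hu, fun k hk ↦ hN k (Finset.mem_insert_of_mem hk)⟩ (hN j (Finset.mem_insert_self _ _))
    · exact Submodule.smul_mem_annihilatedBy (hQT j (Finset.mem_insert_self _ _)) fun k hk ↦
        (hTT j k).sub_algebraMap_pow _ _
    · exact Submodule.smul_mem_annihilatedBy (hQX j (Finset.mem_insert_self _ _)) fun k hk ↦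
        (hTX' k j (hne k hk)).symm.sub_algebraMap_pow _ _
    · intro w hw hwT
      -- The genuine eigenspace of `T j` is stable under `T k` and `X k` for `k ≠ j`, so the
      -- induction over the remaining indices can run inside it.
      let Q'' := Q.annihilatedBy {j} fun k ↦ T k - algebraMap ℂ R (μ k)
      have hmem : ∀ v, v ∈ Q'' ↔ v ∈ Q ∧ T j • v = μ j • v := fun v ↦ by
        refine and_congr_right fun _ ↦ ?_
        simp [sub_smul, sub_eq_zero]
      refine ih Q'' (fun k hk ↦ ?_) (fun k hk ↦ ?_) (fun v hv hvT ↦ ?_) w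
        ((hmem w).2 ⟨hw.1, hwT⟩) hw.2
      · refine Submodule.smul_mem_annihilatedBy (hQT k (Finset.mem_insert_of_mem hk)) fun i hi ↦ ?_
        rw [Finset.mem_singleton.1 hi]
        exact (hTT k j).sub_right (Algebra.commutes _ _).symm
      · refine Submodule.smul_mem_annihilatedBy (hQX k (Finset.mem_insert_of_mem hk)) fun i hi ↦ ?_
        rw [Finset.mem_singleton.1 hi]
        exact (hTX' j k (hne k hk).symm).symm.sub_right (Algebra.commutes _ _).symm
      · have hv' := (hmem v).1 hv
        refine hbase v hv'.1 fun k hk ↦ ?_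
        rcases Finset.mem_insert.1 hk with rfl | hk
        · exact hv'.2
        · exact hvT k hk

end newton

/-! ### Operators that commute up to a scalar. -/

section quasiCommuting

open Polynomial

variable {R M : Type*} [Ring R] [Algebra ℂ R] [AddCommGroup M] [Module ℂ M] [Module R M]
  [IsScalarTower ℂ R M]

/-- The submodule of the vectors that are annihilated by a nonzero polynomial in `a`. -/
def Submodule.algebraicVectors (M : Type*) [AddCommGroup M] [Module ℂ M] [Module R M]
    [IsScalarTower ℂ R M] (a : R) : Submodule ℂ M where
  carrier := {u | ∃ f : ℂ[X], f ≠ 0 ∧ aeval a f • u = 0}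
  add_mem' := by
    rintro u v ⟨f, hf, hfu⟩ ⟨g, hg, hgv⟩
    refine ⟨f * g, mul_ne_zero hf hg, ?_⟩
    rw [smul_add]
    nth_rewrite 1 [mul_comm]
    rw [map_mul, map_mul, mul_smul, mul_smul, hfu, hgv, smul_zero, smul_zero, add_zero]
  zero_mem' := ⟨1, one_ne_zero, smul_zero _⟩
  smul_mem' := by
    rintro c u ⟨f, hf, hfu⟩
    refine ⟨f, hf, ?_⟩
    rw [← algebraMap_smul R c u, ← mul_smul, ← Algebra.commutes, mul_smul, hfu, smul_zero]

theorem SemiconjBy.aeval {a b c : R} (h : SemiconjBy b a c) (f : ℂ[X]) :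
    SemiconjBy b (aeval a f) (aeval c f) := by
  induction f using Polynomial.induction_on' with
  | add p q hp hq =>
    rw [map_add, map_add]
    exact hp.add_right hq
  | monomial k z =>
    rw [aeval_monomial, aeval_monomial]
    exact SemiconjBy.mul_right (Algebra.commutes z b).symm (h.pow_right k)

/-- Moving `b` past `a` rescales the argument, `b f(a) = f(ωa) b`, so `f(ωX)` is a polynomial for `b
• u`. -/
theorem Submodule.smul_mem_algebraicVectors {a b : R} {ω : ℂ} (hω : ω ≠ 0)
    (h : b * a = ω • (a * b)) :
    ∀ u ∈ Submodule.algebraicVectors M a, b • u ∈ Submodule.algebraicVectors M a := by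
  rintro u ⟨f, hf, hfu⟩
  refine ⟨f.comp (C ω * X), ?_, ?_⟩
  · intro h0
    rcases comp_eq_zero_iff.1 h0 with h1 | ⟨-, h1⟩
    · exact hf h1
    · have := congrArg (fun p : ℂ[X] ↦ p.coeff 1) h1
      simp [coeff_C] at this
      exact hω this
  · have h1 : SemiconjBy b a (ω • a) := by
      rw [SemiconjBy, h, smul_mul_assoc]
    have h2 : Polynomial.aeval a (f.comp (C ω * X)) = Polynomial.aeval (ω • a) f := by
      rw [aeval_comp, map_mul, aeval_C, aeval_X, Algebra.smul_def]
    rw [h2, ← mul_smul, ← (h1.aeval f).eq, mul_smul, hfu, smul_zero]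

/-- If `b a = ω a b` for operators that act injectively, and some nonzero vector is annihilated by
nonzero polynomials in `a` and in `b`, then `ω` is a root of unity. -/
theorem exists_pow_eq_one_of_mul_eq_smul_mul {a b : R} {ω : ℂ} (hω : ω ≠ 0)
    (h : b * a = ω • (a * b)) (ha : ∀ u : M, a • u = 0 → u = 0) (hb : ∀ u : M, b • u = 0 → u = 0)
    {t : M} (ht : t ≠ 0) {f g : ℂ[X]} (hf : f ≠ 0) (hg : g ≠ 0) (hft : aeval a f • t = 0)
    (hgt : aeval b g • t = 0) : ∃ d : ℕ, 0 < d ∧ ω ^ d = 1 := by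
  set S := Submodule.algebraicVectors M a
  have hS := Submodule.smul_mem_algebraicVectors (M := M) hω h
  have hΔs : ∀ (μ : ℂ) (w : M), (b - algebraMap ℂ R μ) • w = b • w - μ • w := fun μ w ↦ by
    rw [sub_smul, algebraMap_smul]
  have hsm : ∀ (r : R) (z : ℂ) (w : M), r • (z • w) = z • (r • w) := fun r z w ↦ by
    rw [← algebraMap_smul R z w, ← mul_smul, ← Algebra.commutes, mul_smul, algebraMap_smul]
  -- The space `S` is stable under `b` and contains `t`, which a polynomial in `b` annihilates.
  -- Hence `b` has an eigenvector within `S`.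
  obtain ⟨v, hvS, hv0, μ, hv⟩ : ∃ v ∈ S, v ≠ 0 ∧ ∃ μ : ℂ, b • v = μ • v := by
    by_contra! hne
    refine ht ((Submodule.span_eq_bot.2 ?_).le (mem_span_genEigenvector hS hg ⟨f, hf, hft⟩ hgt))
    rintro w ⟨hw, μ, N, hwN⟩
    induction N generalizing w with
    | zero => simpa using hwN
    | succ N ih =>
      have h1 : (b - algebraMap ℂ R μ) • w = 0 := by
        refine ih _ ?_ (by rwa [← mul_smul, ← pow_succ])
        rw [hΔs]
        exact S.sub_mem (hS _ hw) (S.smul_mem _ hw)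
      by_contra hw0
      exact hne w hw hw0 μ (sub_eq_zero.1 (by rw [← hΔs, h1]))
  have hμ : μ ≠ 0 := by
    rintro rfl
    exact hv0 (hb v (by rw [hv, zero_smul]))
  have hak : ∀ k : ℕ, a ^ k • v ≠ 0 := fun k ↦ by
    induction k with
    | zero => simpa using hv0
    | succ k ih =>
      rw [pow_succ', mul_smul]
      exact fun h0 ↦ ih (ha _ h0)
  have hbk : ∀ k : ℕ, b • a ^ k • v = (ω ^ k * μ) • a ^ k • v := fun k ↦ by
    induction k with
    | zero => simpa using hv
    | succ k ih =>
      rw [pow_succ' a, mul_smul, ← mul_smul, h, smul_assoc, mul_smul, ih, hsm, smul_smul,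
        pow_succ']
      congr 1
      ring
  -- Otherwise the vectors `a ^ k • v` are eigenvectors of `b` with distinct eigenvalues `ω ^ k μ`,
  -- hence linearly independent, although a nonzero polynomial in `a` annihilates `v`.
  by_contra! hd
  have hinj : Function.Injective fun k : ℕ ↦ ω ^ k * μ := by
    have : ∀ k l : ℕ, k < l → ω ^ k ≠ ω ^ l := fun k l hkl hkl' ↦ by
      refine hd (l - k) (Nat.sub_pos_of_lt hkl) ?_
      refine mul_left_cancel₀ (pow_ne_zero k hω) ?_
      rw [← pow_add, Nat.add_sub_cancel' hkl.le, mul_one, hkl']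
    intro k l hkl
    have hkl' := mul_right_cancel₀ hμ hkl
    rcases lt_trichotomy k l with h1 | h1 | h1
    · exact absurd hkl' (this _ _ h1)
    · exact h1
    · exact absurd hkl'.symm (this _ _ h1)
  have hli : LinearIndependent ℂ fun k : ℕ ↦ a ^ k • v := by
    refine Module.End.eigenvectors_linearIndependent' (Algebra.lsmul ℂ ℂ M b)
      (fun k : ℕ ↦ ω ^ k * μ) hinj _ fun k ↦ ?_
    exact Module.End.hasEigenvector_iff.2 ⟨Module.End.mem_eigenspace_iff.2 (hbk k), hak k⟩
  obtain ⟨f', hf', hfv⟩ := hvS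
  refine hf' ?_
  ext k
  rw [aeval_eq_sum_range, Finset.sum_smul] at hfv
  simp only [smul_assoc] at hfv
  by_cases hk : k ∈ Finset.range (f'.natDegree + 1)
  · simpa using linearIndependent_iff'.1 hli _ _ hfv k hk
  · rw [Finset.mem_range, not_lt] at hk
    rw [coeff_eq_zero_of_natDegree_lt hk, coeff_zero]

end quasiCommuting

/-! ### The support conditions as algebraic relations. -/

section annihilation

variable {n : ℕ}

instance isScalarTower_distOp : IsScalarTower ℂ (DistOp n) 𝓢'(En n, ℂ) :=
  ⟨fun _ _ _ ↦ rfl⟩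

open Polynomial in
theorem aeval_list_prod_X_sub_C {R ι : Type*} [Ring R] [Algebra ℂ R] (a : R) (c : ι → ℂ) (N : ℕ)
    (l : List ι) : aeval a (l.map fun i ↦ (X - C (c i)) ^ N).prod =
      (l.map fun i ↦ (a - algebraMap ℂ R (c i)) ^ N).prod := by
  induction l with
  | nil => simp
  | cons i l ih => simp [ih]

open Polynomial in
theorem list_prod_X_sub_C_ne_zero {ι : Type*} (c : ι → ℂ) (N : ℕ) (l : List ι) :
    (l.map fun i ↦ (X - C (c i)) ^ N).prod ≠ 0 := by
  refine List.prod_ne_zero fun h ↦ ?_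
  obtain ⟨i, -, hi⟩ := List.mem_map.1 h
  exact pow_ne_zero N (X_sub_C_ne_zero _) hi

theorem hasTemperateGrowth_planeWave_sub_const (ξ : En n) (c : ℂ) :
    (fun x ↦ planeWave ξ x - c).HasTemperateGrowth :=
  (hasTemperateGrowth_planeWave ξ).sub (.const c)

theorem smulLeftCLM_planeWave_sub_const (ξ : En n) (c : ℂ) :
    (TemperedDistribution.smulLeftCLM ℂ fun x ↦ planeWave ξ x - c : DistOp n) =
      expMul ξ - algebraMap ℂ (DistOp n) c := by
  ext1 t
  have h := TemperedDistribution.smulLeftCLM_sub (F := ℂ) (hasTemperateGrowth_planeWave ξ)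
    (Function.HasTemperateGrowth.const (E := En n) c)
  rw [Algebra.algebraMap_eq_smul_one]
  have h1 : (TemperedDistribution.smulLeftCLM ℂ (fun _ : En n ↦ c) : DistOp n) = c • 1 := by
    ext1 t
    exact TemperedDistribution.smulLeftCLM_const c t
  rw [← h1, expMul_eq_smulLeftCLM, ← h]
  rfl

/-- A tempered distribution supported by an `L`-crystal is annihilated by products of the operators
`e^{2πi⟨ξ,x⟩} - e^{2πi⟨ξ,q⟩}`. -/
theorem exists_prod_expMul_sub_smul_eq_zero {I : ℕ} {L : Submodule ℤ (En n)} {q : Fin I → En n}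
    {t : 𝓢'(En n, ℂ)} (ht : Distribution.dsupport t ⊆ crystal L q) :
    ∃ N : ℕ, ∀ ξ : Fin I → En n, (∀ i, ξ i ∈ dualLattice L) →
      ((List.finRange I).map fun i ↦
        (expMul (ξ i) - algebraMap ℂ (DistOp n) (planeWave (ξ i) (q i))) ^ N).prod • t = 0 := by
  -- `N` depends on `t` alone, hence is uniform in the `ξ i`. The product of the differences
  -- vanishes on the crystal, since its `i`-th factor vanishes on `L + q i`.
  obtain ⟨N, hN⟩ := TemperedDistribution.exists_smulLeftCLM_pow_eq_zero t
  refine ⟨N, fun ξ hξ ↦ ?_⟩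
  let g : List (Fin I) → En n → ℂ := fun l ↦
    (l.map fun i ↦ fun x ↦ planeWave (ξ i) x - planeWave (ξ i) (q i)).prod
  have hg : ∀ l, (g l).HasTemperateGrowth ∧ (TemperedDistribution.smulLeftCLM ℂ (g l ^ N) =
      (l.map fun i ↦ (expMul (ξ i) - algebraMap ℂ (DistOp n) (planeWave (ξ i) (q i))) ^ N).prod) ∧
      ∀ i ∈ l, ∀ x, planeWave (ξ i) x = planeWave (ξ i) (q i) → g l x = 0 := by
    intro l
    induction l with
    | nil =>
      have h1 : (g [] : En n → ℂ).HasTemperateGrowth := .const 1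
      refine ⟨h1, ?_, by simp⟩
      have h2 : g [] ^ N = g [] ^ 0 := by simp [g]
      rw [h2, smulLeftCLM_pow h1, pow_zero, List.map_nil, List.prod_nil]
    | cons i l ih =>
      obtain ⟨h1, h2, h3⟩ := ih
      have hi := hasTemperateGrowth_planeWave_sub_const (ξ i) (planeWave (ξ i) (q i))
      have h4 : g (i :: l) = (fun x ↦ planeWave (ξ i) x - planeWave (ξ i) (q i)) * g l := by
        simp only [g, List.map_cons, List.prod_cons]
      refine ⟨h4 ▸ hi.mul h1, ?_, ?_⟩
      · rw [h4, mul_pow, ← smulLeftCLM_mul_smulLeftCLM (hi.pow N) (h1.pow N), h2,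
          smulLeftCLM_pow hi, smulLeftCLM_planeWave_sub_const, List.map_cons, List.prod_cons]
      · intro k hk x hx
        rw [h4, Pi.mul_apply]
        rcases List.mem_cons.1 hk with rfl | hk
        · rw [hx, sub_self, zero_mul]
        · rw [h3 k hk x hx, mul_zero]
  obtain ⟨h1, h2, h3⟩ := hg (List.finRange I)
  rw [← h2]
  refine hN _ h1 fun x hx ↦ ?_
  obtain ⟨i, p, hp, rfl⟩ := Set.mem_iUnion.1 (ht hx)
  refine h3 i (List.mem_finRange i) _ ?_
  rw [planeWave_add_right, planeWave_eq_one_of_mem (hξ i) hp, one_mul]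

theorem fourier_list_prod_shiftBy_sub {ι : Type*} (p : ι → En n) (c : ι → ℂ) (N : ℕ) (l : List ι)
    (t : 𝓢'(En n, ℂ)) :
    (𝓕 ((l.map fun i ↦ (shiftBy (p i) - algebraMap ℂ (DistOp n) (c i)) ^ N).prod • t) :
        𝓢'(En n, ℂ)) =
      (l.map fun i ↦ (expMul (-p i) - algebraMap ℂ (DistOp n) (c i)) ^ N).prod •
        (𝓕 t : 𝓢'(En n, ℂ)) := by
  have h1 : ∀ i (t : 𝓢'(En n, ℂ)),
      (𝓕 ((shiftBy (p i) - algebraMap ℂ (DistOp n) (c i)) • t) : 𝓢'(En n, ℂ)) =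
        (expMul (-p i) - algebraMap ℂ (DistOp n) (c i)) • (𝓕 t : 𝓢'(En n, ℂ)) := fun i t ↦ by
    rw [sub_smul, sub_smul, algebraMap_smul, algebraMap_smul]
    change 𝓕 (shiftBy (p i) t - c i • t) = expMul (-p i) (𝓕 t) - c i • 𝓕 t
    rw [← fourier_shiftBy]
    exact ((FourierTransform.fourierCLM ℂ 𝓢'(En n, ℂ)).map_sub _ _).trans
      (congrArg _ ((FourierTransform.fourierCLM ℂ 𝓢'(En n, ℂ)).map_smul _ _))
  have h2 : ∀ i (k : ℕ) (t : 𝓢'(En n, ℂ)),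
      (𝓕 ((shiftBy (p i) - algebraMap ℂ (DistOp n) (c i)) ^ k • t) : 𝓢'(En n, ℂ)) =
        (expMul (-p i) - algebraMap ℂ (DistOp n) (c i)) ^ k • (𝓕 t : 𝓢'(En n, ℂ)) := fun i k ↦ by
    induction k with
    | zero => intro t; simp
    | succ k ih =>
      intro t
      rw [pow_succ, pow_succ, mul_smul, mul_smul, ih, h1]
  induction l generalizing t with
  | nil => simp
  | cons i l ih => rw [List.map_cons, List.prod_cons, List.map_cons, List.prod_cons, mul_smul,
      mul_smul, h2, ih]

/-- The annihilation statement for `𝓕 t`, pulled back: the Fourier transform turns the shift by `p`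
into the character of `-p`, whence the sign in the eigenvalues. -/
theorem exists_prod_shiftBy_sub_smul_eq_zero {K : ℕ} {Γ : Submodule ℤ (En n)} {η : Fin K → En n}
    {t : 𝓢'(En n, ℂ)} (ht : Distribution.dsupport (𝓕 t : 𝓢'(En n, ℂ)) ⊆ crystal Γ η) :
    ∃ N : ℕ, ∀ p : Fin K → En n, (∀ k, p k ∈ dualLattice Γ) →
      ((List.finRange K).map fun k ↦
        (shiftBy (p k) - algebraMap ℂ (DistOp n) (planeWave (-p k) (η k))) ^ N).prod • t = 0 := by
  obtain ⟨N, hN⟩ := exists_prod_expMul_sub_smul_eq_zero ht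
  refine ⟨N, fun p hp ↦ fourier_injective ?_⟩
  simp only [fourier_list_prod_shiftBy_sub]
  rw [hN (fun k ↦ -p k) fun k ↦ neg_mem (hp k)]
  exact ((FourierTransform.fourierCLM ℂ 𝓢'(En n, ℂ)).map_zero).symm

end annihilation

/-! ### Commensurability and change of crystal. -/

section commensurability

variable {n I K : ℕ} {L Γ : Submodule ℤ (En n)} {q : Fin I → En n} {η : Fin K → En n}
  {t : 𝓢'(En n, ℂ)}

theorem expMul_smul_eq_zero {ξ : En n} {u : 𝓢'(En n, ℂ)} (h : expMul ξ • u = 0) : u = 0 := by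
  rw [← expMul_neg_expMul ξ u]
  exact (congrArg (expMul (-ξ)) h).trans (map_zero _)

theorem shiftBy_smul_eq_zero {p : En n} {u : 𝓢'(En n, ℂ)} (h : shiftBy p • u = 0) : u = 0 := by
  rw [← shiftBy_neg_shiftBy p u]
  exact (congrArg (shiftBy (-p)) h).trans (map_zero _)

/-- With constant families the annihilating products become polynomials in a single modulation and a
single shift. Their Weyl phase is then a root of unity. -/
theorem exists_nat_mul_inner_eq_int (ht : Distribution.dsupport t ⊆ crystal L q)
    (ht' : Distribution.dsupport (𝓕 t : 𝓢'(En n, ℂ)) ⊆ crystal Γ η) (ht0 : t ≠ 0) {ξ γ : En n}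
    (hξ : ξ ∈ dualLattice L) (hγ : γ ∈ dualLattice Γ) :
    ∃ d : ℕ, 0 < d ∧ ∃ m : ℤ, (m : ℝ) = d * inner ℝ ξ γ := by
  obtain ⟨N, hN⟩ := exists_prod_expMul_sub_smul_eq_zero ht
  obtain ⟨N', hN'⟩ := exists_prod_shiftBy_sub_smul_eq_zero ht'
  have h1 := hN (fun _ ↦ ξ) fun _ ↦ hξ
  have h2 := hN' (fun _ ↦ γ) fun _ ↦ hγ
  rw [← aeval_list_prod_X_sub_C] at h1 h2
  obtain ⟨d, hd, hd1⟩ := exists_pow_eq_one_of_mul_eq_smul_mul (planeWave_ne_zero ξ γ)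
    (expMul_mul_shiftBy ξ γ) (fun _ ↦ shiftBy_smul_eq_zero) (fun _ ↦ expMul_smul_eq_zero) ht0
    (list_prod_X_sub_C_ne_zero _ _ _) (list_prod_X_sub_C_ne_zero _ _ _) h2 h1
  refine ⟨d, hd, ?_⟩
  have h3 : ∀ k : ℕ, planeWave (k • ξ) γ = planeWave ξ γ ^ k := fun k ↦ by
    induction k with
    | zero => simp
    | succ k ih => rw [succ_nsmul, planeWave_add_left, ih, pow_succ]
  obtain ⟨m, hm⟩ := planeWave_eq_one_iff.1 ((h3 d).trans hd1)
  exact ⟨m, by rw [hm, ← Nat.cast_smul_eq_nsmul ℝ, real_inner_smul_left]⟩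

/-- The product of the denominators of the finitely many numbers `⟨ξ j, γ k⟩`, with `γ` a basis of
`Γ*`, clears them all. -/
theorem exists_nat_smul_mem [DiscreteTopology L] [IsZLattice ℝ L] [DiscreteTopology Γ]
    [IsZLattice ℝ Γ] {p ξ : Fin n → En n} (hL : IsDualBases L p ξ)
    (h : ∀ x ∈ dualLattice L, ∀ γ ∈ dualLattice Γ,
      ∃ d : ℕ, 0 < d ∧ ∃ m : ℤ, (m : ℝ) = d * inner ℝ x γ) :
    ∃ d : ℕ, 0 < d ∧ ∀ j, d • ξ j ∈ Γ := by
  obtain ⟨g, γ, hΓ⟩ := exists_isDualBases Γ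
  have h' : ∀ j k, ∃ d : ℕ, 0 < d ∧ ∃ m : ℤ, (m : ℝ) = d * inner ℝ (ξ j) (γ k) := fun j k ↦
    h _ (hL.right_mem j) _ (hΓ.right_mem k)
  choose d hd m hm using h'
  refine ⟨∏ i : Fin n × Fin n, d i.1 i.2, Finset.prod_pos fun _ _ ↦ hd _ _, fun j ↦ ?_⟩
  refine (hΓ.mem_iff _).2 fun k ↦ ?_
  obtain ⟨e, he⟩ := Finset.dvd_prod_of_mem (fun i : Fin n × Fin n ↦ d i.1 i.2)
    (Finset.mem_univ (j, k))
  refine ⟨e * m j k, ?_⟩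
  rw [he, ← Nat.cast_smul_eq_nsmul ℝ, real_inner_smul_right, real_inner_comm]
  push_cast
  rw [hm]
  ring

/-- The intersection contains the vectors `d • ξ j`, so it is a full-rank lattice. Its index in a
larger lattice is a quotient of positive covolumes, hence not the value 0 by which `relIndex`
encodes infinite index. -/
theorem commensurable_dualLattice [DiscreteTopology L] [IsZLattice ℝ L] [DiscreteTopology Γ]
    [IsZLattice ℝ Γ] (h : ∀ x ∈ dualLattice L, ∀ γ ∈ dualLattice Γ,
      ∃ d : ℕ, 0 < d ∧ ∃ m : ℤ, (m : ℝ) = d * inner ℝ x γ) :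
    AddSubgroup.Commensurable Γ.toAddSubgroup (dualLattice L).toAddSubgroup := by
  obtain ⟨p, ξ, hL⟩ := exists_isDualBases L
  obtain ⟨d, hd, hdξ⟩ := exists_nat_smul_mem hL h
  have hdisc : DiscreteTopology (Γ ⊓ dualLattice L : Submodule ℤ (En n)) :=
    DiscreteTopology.of_subset (s := (Γ : Set (En n))) inferInstance inf_le_left
  have hlat : IsZLattice ℝ (Γ ⊓ dualLattice L : Submodule ℤ (En n)) := by
    refine ⟨eq_top_iff.2 fun x _ ↦ ?_⟩
    rw [hL.sum_right x]
    refine Submodule.sum_mem _ fun j _ ↦ Submodule.smul_mem _ _ ?_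
    have hd' : (d : ℝ) ≠ 0 := Nat.cast_ne_zero.2 hd.ne'
    rw [← inv_smul_smul₀ hd' (ξ j), Nat.cast_smul_eq_nsmul]
    exact Submodule.smul_mem _ _ (Submodule.subset_span
      ⟨hdξ j, nsmul_mem (hL.right_mem j) d⟩)
  have key : ∀ (Λ : Submodule ℤ (En n)) [DiscreteTopology Λ] [IsZLattice ℝ Λ],
      Γ ⊓ dualLattice L ≤ Λ →
      (Γ ⊓ dualLattice L).toAddSubgroup.relIndex Λ.toAddSubgroup ≠ 0 := by
    intro Λ _ _ hle h0
    have h1 := ZLattice.covolume_div_covolume_eq_relIndex' _ Λ hle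
    rw [h0, Nat.cast_zero] at h1
    exact (div_pos (ZLattice.covolume_pos _ _) (ZLattice.covolume_pos _ _)).ne' h1
  exact ⟨(AddSubgroup.inf_relIndex_right Γ.toAddSubgroup (dualLattice L).toAddSubgroup) ▸
      key (dualLattice L) inf_le_right,
    (AddSubgroup.inf_relIndex_left Γ.toAddSubgroup (dualLattice L).toAddSubgroup) ▸
      key Γ inf_le_left⟩

/-- The new shifts are the old ones translated by representatives of the finitely many cosets of `Λ
∩ Γ` in `Γ`. -/
theorem exists_crystal_subset {Λ : Submodule ℤ (En n)}
    (h : Λ.toAddSubgroup.relIndex Γ.toAddSubgroup ≠ 0) (η : Fin K → En n) :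
    ∃ (K' : ℕ) (η' : Fin K' → En n), (∀ k, η' k ∈ crystal Γ η) ∧
      crystal Γ η ⊆ crystal Λ η' := by
  have hfin : (Λ.toAddSubgroup.addSubgroupOf Γ.toAddSubgroup).FiniteIndex := ⟨h⟩
  let Q := Γ.toAddSubgroup ⧸ Λ.toAddSubgroup.addSubgroupOf Γ.toAddSubgroup
  obtain ⟨K', ⟨e⟩⟩ := Finite.exists_equiv_fin (Q × Fin K)
  refine ⟨K', fun k ↦ ((e.symm k).1.out : Γ.toAddSubgroup) + η (e.symm k).2, fun k ↦ ?_, ?_⟩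
  · exact Set.mem_iUnion.2 ⟨(e.symm k).2, _, ((e.symm k).1.out : Γ.toAddSubgroup).2, rfl⟩
  · intro x hx
    obtain ⟨k, γ, hγ, rfl⟩ := Set.mem_iUnion.1 hx
    let c : Q := QuotientAddGroup.mk (⟨γ, hγ⟩ : Γ.toAddSubgroup)
    refine Set.mem_iUnion.2 ⟨e (c, k), -(c.out : Γ.toAddSubgroup) + γ, ?_, ?_⟩
    · have h1 : QuotientAddGroup.mk c.out = c := QuotientAddGroup.out_eq' c
      exact AddSubgroup.mem_addSubgroupOf.1 (QuotientAddGroup.eq.1 h1)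
    · simp only [Equiv.symm_apply_apply]
      abel

end commensurability

/-! ### Spaces of differential operators applied to a distribution. -/

section operatorSpan

variable {n : ℕ}

theorem mul_list_ofFn_pow_prod {R : Type*} [Monoid R] {Y : Fin n → R}
    (hY : ∀ i k, Commute (Y i) (Y k)) (a : Fin n → ℕ) (j : Fin n) :
    Y j * (List.ofFn fun i ↦ Y i ^ a i).prod =
      (List.ofFn fun i ↦ Y i ^ (a i + if i = j then 1 else 0)).prod := by
  induction n with
  | zero => exact j.elim0
  | succ n ih =>
    rw [List.ofFn_succ, List.ofFn_succ, List.prod_cons, List.prod_cons]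
    refine Fin.cases ?_ (fun j ↦ ?_) j
    · rw [← mul_assoc, ← pow_succ']
      simp
    · rw [← mul_assoc, ((hY j.succ 0).pow_right (a 0)).eq, mul_assoc,
        ih (Y := fun i ↦ Y i.succ) (fun i k ↦ hY _ _) (fun i ↦ a i.succ) j]
      simp [(Fin.succ_ne_zero j).symm]

/-- The operator `x^α D^β`. -/
noncomputable def monomialOp (m : Fin n ⊕ Fin n →₀ ℕ) : DistOp n :=
  (List.ofFn fun i ↦ mulX i ^ m (Sum.inl i)).prod *
    (List.ofFn fun i ↦ partialD i ^ m (Sum.inr i)).prod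

theorem polyDiffOp_apply (P : MvPolynomial (Fin n ⊕ Fin n) ℂ) (u : 𝓢'(En n, ℂ)) :
    polyDiffOp P u = ∑ m ∈ P.support, P.coeff m • monomialOp m u := by
  rw [polyDiffOp, opSubst, sum_apply]
  rfl

/-- The space of all `P(x, D) u`. -/
noncomputable def diffOpSpan (u : 𝓢'(En n, ℂ)) : Submodule ℂ 𝓢'(En n, ℂ) :=
  Submodule.span ℂ (Set.range fun m : Fin n ⊕ Fin n →₀ ℕ ↦ monomialOp m u)

theorem exists_polyDiffOp_eq {u v : 𝓢'(En n, ℂ)} (hv : v ∈ diffOpSpan u) :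
    ∃ P : MvPolynomial (Fin n ⊕ Fin n) ℂ, v = polyDiffOp P u := by
  obtain ⟨c, rfl⟩ := Finsupp.mem_span_range_iff_exists_finsupp.1 hv
  refine ⟨(MvPolynomial.basisMonomials _ ℂ).repr.symm c, ?_⟩
  rw [polyDiffOp_apply]
  rfl

theorem mulX_mul_monomialOp (j : Fin n) (m : Fin n ⊕ Fin n →₀ ℕ) :
    mulX j * monomialOp m = monomialOp (m + Finsupp.single (Sum.inl j) 1) := by
  rw [monomialOp, monomialOp, ← mul_assoc,
    mul_list_ofFn_pow_prod (Y := fun i ↦ (mulX i : DistOp n)) commute_mulX]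
  congr 3
  · funext i
    simp [Finsupp.single_apply, eq_comm]
  · simp

theorem partialD_mul_list_prod (j : Fin n) (b : Fin n → ℕ) :
    partialD j * (List.ofFn fun i ↦ (partialD i : DistOp n) ^ b i).prod =
      (List.ofFn fun i ↦ (partialD i : DistOp n) ^ (b i + if i = j then 1 else 0)).prod :=
  mul_list_ofFn_pow_prod (Y := fun i ↦ (partialD i : DistOp n)) commute_partialD b j

theorem innerMul_mem_diffOpSpan (ξ : En n) (u : 𝓢'(En n, ℂ)) :
    ∀ v ∈ diffOpSpan u, innerMul ξ • v ∈ diffOpSpan u := by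
  intro v hv
  rw [innerMul_eq_sum, Finset.sum_smul]
  refine Submodule.sum_mem _ fun j _ ↦ ?_
  rw [smul_assoc]
  refine Submodule.smul_mem _ _ ?_
  change v ∈ (diffOpSpan u).comap (mulX j).toLinearMap
  refine Submodule.span_le.2 ?_ hv
  rintro _ ⟨m, rfl⟩
  refine Submodule.subset_span ⟨m + Finsupp.single (Sum.inl j) 1, ?_⟩
  simp only [← mulX_mul_monomialOp]
  rfl

/-- The space of all `P(D) u`. -/
noncomputable def derivSpan (u : 𝓢'(En n, ℂ)) : Submodule ℂ 𝓢'(En n, ℂ) :=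
  Submodule.span ℂ (Set.range fun b : Fin n → ℕ ↦
    (List.ofFn fun i ↦ (partialD i : DistOp n) ^ b i).prod u)

theorem dirD_mem_derivSpan (p : En n) (u : 𝓢'(En n, ℂ)) :
    ∀ v ∈ derivSpan u, dirD p • v ∈ derivSpan u := by
  intro v hv
  rw [dirD_eq_sum, Finset.sum_smul]
  refine Submodule.sum_mem _ fun j _ ↦ ?_
  rw [smul_assoc]
  refine Submodule.smul_mem _ _ ?_
  change v ∈ (derivSpan u).comap (partialD j).toLinearMap
  refine Submodule.span_le.2 ?_ hv
  rintro _ ⟨b, rfl⟩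
  refine Submodule.subset_span ⟨fun i ↦ b i + if i = j then 1 else 0, ?_⟩
  simp only [← partialD_mul_list_prod]
  rfl

theorem self_mem_derivSpan (u : 𝓢'(En n, ℂ)) : u ∈ derivSpan u := by
  refine Submodule.subset_span ⟨0, ?_⟩
  have : (List.ofFn fun i : Fin n ↦ (partialD i : DistOp n) ^ (0 : Fin n → ℕ) i).prod = 1 := by
    refine List.prod_eq_one fun x hx ↦ ?_
    obtain ⟨i, rfl⟩ := (List.mem_ofFn' _ _).1 hx
    simp
  simp only [this]
  rfl

/-- Derivatives are created first, inside `derivSpan`, and multiplications afterwards, inside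
`diffOpSpan`. The normal order `x^α D^β` therefore never has to be restored by commuting. -/
theorem derivSpan_le_diffOpSpan (u : 𝓢'(En n, ℂ)) : derivSpan u ≤ diffOpSpan u := by
  refine Submodule.span_le.2 ?_
  rintro _ ⟨b, rfl⟩
  refine Submodule.subset_span ⟨Finsupp.equivFunOnFinite.symm (Sum.elim 0 b), ?_⟩
  have : (List.ofFn fun i : Fin n ↦ (mulX i : DistOp n) ^
      Finsupp.equivFunOnFinite.symm (Sum.elim (0 : Fin n → ℕ) b) (Sum.inl i)).prod = 1 := by
    refine List.prod_eq_one fun x hx ↦ ?_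
    obtain ⟨i, rfl⟩ := (List.mem_ofFn' _ _).1 hx
    simp
  simp only [monomialOp, this, one_mul]
  rfl

end operatorSpan

/-! ### Differential operators on the Fourier side. -/

section fourierOp

variable {n : ℕ}

/-- `A'` is the operator on the Fourier side that corresponds to `A`. -/
def IsFourierConj (A A' : DistOp n) : Prop :=
  ∀ u : 𝓢'(En n, ℂ), (𝓕 (A u) : 𝓢'(En n, ℂ)) = A' (𝓕 u)

namespace IsFourierConj

variable {A A' B B' : DistOp n}

theorem mul (h : IsFourierConj A A') (h' : IsFourierConj B B') : IsFourierConj (A * B) (A' * B') :=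
  fun u ↦ (h (B u)).trans (congrArg A' (h' u))

theorem one : IsFourierConj (1 : DistOp n) 1 := fun _ ↦ rfl

theorem pow (h : IsFourierConj A A') (k : ℕ) : IsFourierConj (A ^ k) (A' ^ k) := by
  induction k with
  | zero => exact one
  | succ k ih =>
    rw [pow_succ, pow_succ]
    exact ih.mul h

theorem smul (h : IsFourierConj A A') (c : ℂ) : IsFourierConj (c • A) (c • A') := fun u ↦
  ((FourierTransform.fourierCLM ℂ 𝓢'(En n, ℂ)).map_smul c (A u)).trans (congrArg (c • ·) (h u))

theorem sum {ι : Type*} {s : Finset ι} {A A' : ι → DistOp n}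
    (h : ∀ i ∈ s, IsFourierConj (A i) (A' i)) :
    IsFourierConj (∑ i ∈ s, A i) (∑ i ∈ s, A' i) := fun u ↦ by
  rw [sum_apply, sum_apply]
  refine (map_sum (FourierTransform.fourierCLM ℂ 𝓢'(En n, ℂ)) _ _).trans ?_
  exact Finset.sum_congr rfl fun i hi ↦ h i hi u

theorem list_ofFn_prod {m : ℕ} {A A' : Fin m → DistOp n} (h : ∀ i, IsFourierConj (A i) (A' i)) :
    IsFourierConj (List.ofFn A).prod (List.ofFn A').prod := by
  induction m with
  | zero => exact one
  | succ m ih =>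
    rw [List.ofFn_succ, List.ofFn_succ, List.prod_cons, List.prod_cons]
    exact (h 0).mul (ih fun i ↦ h i.succ)

theorem opSubst {X X' Y Y' : Fin n → DistOp n} (hX : ∀ i, IsFourierConj (X i) (X' i))
    (hY : ∀ i, IsFourierConj (Y i) (Y' i)) (P : MvPolynomial (Fin n ⊕ Fin n) ℂ) :
    IsFourierConj (opSubst P X Y) (_root_.opSubst P X' Y') :=
  sum fun _ _ ↦ ((list_ofFn_prod fun i ↦ (hX i).pow _).mul
    (list_ofFn_prod fun i ↦ (hY i).pow _)).smul _

end IsFourierConj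

theorem fourier_polyDiffOp (P : MvPolynomial (Fin n ⊕ Fin n) ℂ) (u : 𝓢'(En n, ℂ)) :
    (𝓕 (polyDiffOp P u) : 𝓢'(En n, ℂ)) = fourierPolyDiffOp P (𝓕 u) :=
  IsFourierConj.opSubst fourier_mulX fourier_partialD P u

end fourierOp

/-! ### The Poisson form. -/

section poissonForm

variable {n : ℕ} {L : Submodule ℤ (En n)} {p ξ : Fin n → En n}

theorem IsDualBases.le_of_forall_left_mem (h : IsDualBases L p ξ) {S : AddSubgroup (En n)}
    (hS : ∀ j, p j ∈ S) {x : En n} (hx : x ∈ L) : x ∈ S := by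
  rw [h.sum_left x]
  refine sum_mem fun j _ ↦ ?_
  obtain ⟨m, hm⟩ := (h.mem_iff x).1 hx j
  rw [← hm, Int.cast_smul_eq_zsmul]
  exact zsmul_mem (hS j) m

theorem IsDualBases.expMul_eq_of_forall (h : IsDualBases L p ξ) {q : En n} {v : 𝓢'(En n, ℂ)}
    (hv : ∀ j, expMul (ξ j) v = planeWave (ξ j) q • v) {x : En n} (hx : x ∈ dualLattice L) :
    expMul x v = planeWave x q • v := by
  let S : AddSubgroup (En n) :=
    { carrier := {x | expMul x v = planeWave x q • v}
      zero_mem' := by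
        simp [expMul_zero]
      add_mem' := fun {x y} (hx : _ = _) (hy : _ = _) ↦ by
        change expMul (x + y) v = planeWave (x + y) q • v
        rw [expMul_add, mul_apply_eq_comp, hy, map_smul, hx, smul_smul,
          planeWave_add_left, mul_comm]
      neg_mem' := fun {x} (hx : _ = _) ↦ by
        change expMul (-x) v = planeWave (-x) q • v
        have h1 := expMul_neg_expMul x v
        rw [hx, map_smul] at h1
        rw [planeWave_neg_left, eq_inv_smul_iff₀ (planeWave_ne_zero x q), h1] }
  exact h.symm.le_of_forall_left_mem (S := S) hv hx

theorem IsDualBases.shiftBy_eq_of_forall (h : IsDualBases L p ξ) {v : 𝓢'(En n, ℂ)}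
    (hv : ∀ j, shiftBy (p j) v = v) {x : En n} (hx : x ∈ L) : shiftBy x v = v := by
  let S : AddSubgroup (En n) :=
    { carrier := {x | shiftBy x v = v}
      zero_mem' := by
        simp [shiftBy_zero]
      add_mem' := fun {x y} (hx : _ = _) (hy : _ = _) ↦ by
        change shiftBy (x + y) v = v
        rw [shiftBy_add, mul_apply_eq_comp, hy, hx]
      neg_mem' := fun {x} (hx : _ = _) ↦ by
        change shiftBy (-x) v = v
        conv_lhs => rw [← hx]
        exact shiftBy_neg_shiftBy x v }
  exact h.le_of_forall_left_mem (S := S) hv hx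

theorem commute_expMul_shiftBy {x y : En n} (h : planeWave x y = 1) :
    Commute (expMul x) (shiftBy y) := by
  rw [Commute, SemiconjBy, expMul_mul_shiftBy, h, one_smul]

theorem IsDualBases.commute_expMul_shiftBy (h : IsDualBases L p ξ) (j k : Fin n) :
    Commute (expMul (ξ j)) (shiftBy (p k)) :=
  _root_.commute_expMul_shiftBy (planeWave_eq_one_of_mem (h.right_mem j) (h.left_mem k))

/-- The inner reduction, within the shift-invariant distributions: `mem_of_forall_genEigenvector`
with `T` the modulations, `X` the derivatives along `p j` and `c = -2πi`. The genuine joint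
eigenvectors are multiples of the comb. -/
theorem IsDualBases.mem_derivSpan_comb [DiscreteTopology L] [IsZLattice ℝ L]
    (h : IsDualBases L p ξ) (q : En n) {N : Fin n → ℕ} {u : 𝓢'(En n, ℂ)}
    (hE : ∀ j, (expMul (ξ j) - algebraMap ℂ (DistOp n) (planeWave (ξ j) q)) ^ N j • u = 0)
    (hS : ∀ j, shiftBy (p j) • u = u) : u ∈ derivSpan (comb L q) := by
  let Q : Submodule ℂ 𝓢'(En n, ℂ) :=
    (⊤ : Submodule ℂ 𝓢'(En n, ℂ)).annihilatedBy Finset.univ fun j ↦ shiftBy (p j) - (1 : DistOp n)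
  have hQ : ∀ v, v ∈ Q ↔ ∀ j, shiftBy (p j) • v = v := fun v ↦
    ⟨fun hv j ↦ by simpa [sub_smul, sub_eq_zero] using hv.2 j (Finset.mem_univ j),
      fun hv ↦ ⟨trivial, fun j _ ↦ by simp only [sub_smul, hv j, one_smul, sub_self]⟩⟩
  refine mem_of_forall_genEigenvector (R := DistOp n) (T := fun j ↦ expMul (ξ j))
    (X := fun j ↦ dirD (p j)) (c := fun _ ↦ -(2 * Real.pi * Complex.I))
    (μ := fun j ↦ planeWave (ξ j) q) (fun _ ↦ neg_ne_zero.2 Complex.two_pi_I_ne_zero)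
    (fun j ↦ planeWave_ne_zero _ _) (fun j ↦ ?_) (fun j k hjk ↦ ?_) (fun j k ↦ commute_expMul _ _)
    (fun j ↦ dirD_mem_derivSpan _ _) N Finset.univ Q
    (fun j _ ↦ Submodule.smul_mem_annihilatedBy (fun _ _ ↦ trivial) fun k _ ↦
      (h.commute_expMul_shiftBy j k).sub_right (Commute.one_right _))
    (fun j _ ↦ Submodule.smul_mem_annihilatedBy (fun _ _ ↦ trivial) fun k _ ↦
      (commute_shiftBy_dirD (p k) (p j)).symm.sub_right (Commute.one_right _))
    (fun v hv hvE ↦ ?_) u ((hQ u).2 hS) fun j _ ↦ hE j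
  · rw [expMul_mul_dirD, h.inner_eq, if_pos rfl, Algebra.algebraMap_eq_smul_one]
    congr 1
    rw [neg_smul, ← sub_eq_add_neg]
    simp
  · rw [Commute, SemiconjBy, expMul_mul_dirD, h.inner_eq, if_neg hjk]
    simp
  · obtain ⟨c, rfl⟩ := exists_eq_smul_comb L q
      (fun x hx ↦ h.expMul_eq_of_forall (fun j ↦ hvE j (Finset.mem_univ j)) hx)
      (fun x hx ↦ h.shiftBy_eq_of_forall ((hQ v).1 hv) hx)
    exact Submodule.smul_mem _ _ (self_mem_derivSpan _)

/-- The outer reduction: `T` are the shifts, `X` the linear forms `⟨ξ j, x⟩`, `c = -1`. It runs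
within the generalised eigenspace of the modulations, and its base case is `mem_derivSpan_comb`. -/
theorem IsDualBases.mem_diffOpSpan_comb [DiscreteTopology L] [IsZLattice ℝ L]
    (h : IsDualBases L p ξ) (q : En n) {N N' : Fin n → ℕ} {u : 𝓢'(En n, ℂ)}
    (hE : ∀ j, (expMul (ξ j) - algebraMap ℂ (DistOp n) (planeWave (ξ j) q)) ^ N j • u = 0)
    (hS : ∀ j, (shiftBy (p j) - algebraMap ℂ (DistOp n) 1) ^ N' j • u = 0) :
    u ∈ diffOpSpan (comb L q) := by
  let Q : Submodule ℂ 𝓢'(En n, ℂ) :=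
    (⊤ : Submodule ℂ 𝓢'(En n, ℂ)).annihilatedBy Finset.univ fun j ↦
      (expMul (ξ j) - algebraMap ℂ (DistOp n) (planeWave (ξ j) q)) ^ N j
  refine mem_of_forall_genEigenvector (R := DistOp n) (T := fun j ↦ shiftBy (p j))
    (X := fun j ↦ innerMul (ξ j)) (c := fun _ ↦ -1)
    (μ := fun j ↦ 1) (fun _ ↦ neg_ne_zero.2 one_ne_zero)
    (fun j ↦ one_ne_zero) (fun j ↦ ?_) (fun j k hjk ↦ ?_) (fun j k ↦ commute_shiftBy _ _)
    (fun j ↦ innerMul_mem_diffOpSpan _ _) N' Finset.univ Q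
    (fun j _ ↦ Submodule.smul_mem_annihilatedBy (fun _ _ ↦ trivial) fun k _ ↦
      (h.commute_expMul_shiftBy k j).symm.sub_algebraMap_pow _ _)
    (fun j _ ↦ Submodule.smul_mem_annihilatedBy (fun _ _ ↦ trivial) fun k _ ↦
      (commute_expMul_innerMul (ξ k) (ξ j)).symm.sub_algebraMap_pow _ _)
    (fun v hv hvS ↦ ?_) u ⟨trivial, fun j _ ↦ hE j⟩ fun j _ ↦ hS j
  · rw [shiftBy_mul_innerMul, h.inner_eq, if_pos rfl, Algebra.algebraMap_eq_smul_one]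
    congr 1
    rw [neg_smul, ← sub_eq_add_neg]
    simp
  · rw [Commute, SemiconjBy, shiftBy_mul_innerMul, h.inner_eq, if_neg hjk.symm]
    simp
  · exact derivSpan_le_diffOpSpan _ (h.mem_derivSpan_comb q (fun j ↦ hv.2 j (Finset.mem_univ j))
      fun j ↦ (hvS j (Finset.mem_univ j)).trans (one_smul ℂ v))

/-- Demodulation by `η` normalises the shift eigenvalue `exp(-2πi⟨p,η⟩)` to 1; the scalar power
compensates the Weyl phase. -/
theorem semiconjBy_expMul_neg_shiftBy (η p : En n) (N : ℕ) :
    SemiconjBy (expMul (-η)) (planeWave η p ^ N •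
      (shiftBy p - algebraMap ℂ (DistOp n) (planeWave (-p) η)) ^ N)
      ((shiftBy p - algebraMap ℂ (DistOp n) 1) ^ N) := by
  rw [← smul_pow]
  refine SemiconjBy.pow_right ?_ N
  have h1 : planeWave η p * planeWave (-p) η = 1 := by
    rw [planeWave_neg_left, planeWave_comm p, mul_inv_cancel₀ (planeWave_ne_zero _ _)]
  rw [SemiconjBy, mul_smul_comm, mul_sub, sub_mul, expMul_mul_shiftBy, smul_sub, smul_smul,
    planeWave_neg_left η, mul_inv_cancel₀ (planeWave_ne_zero _ _), one_smul, map_one, one_mul,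
    Algebra.algebraMap_eq_smul_one, mul_smul_comm, smul_smul, h1, one_smul, mul_one]

/-- A tempered distribution supported by a crystal whose Fourier transform is supported by a crystal
of the dual lattice is a sum of modulated images of Dirac combs under differential operators with
polynomial coefficients. -/
theorem exists_eq_sum_expMul_polyDiffOp_comb {I K : ℕ} [DiscreteTopology L] [IsZLattice ℝ L]
    {q : Fin I → En n} {η : Fin K → En n} {t : 𝓢'(En n, ℂ)}
    (ht : Distribution.dsupport t ⊆ crystal L q)
    (ht' : Distribution.dsupport (𝓕 t : 𝓢'(En n, ℂ)) ⊆ crystal (dualLattice L) η) :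
    ∃ P : Fin I → Fin K → MvPolynomial (Fin n ⊕ Fin n) ℂ,
      t = ∑ k, ∑ i, expMul (η k) (polyDiffOp (P i k) (comb L (q i))) := by
  obtain ⟨p, ξ, h⟩ := exists_isDualBases L
  obtain ⟨N, hN⟩ := exists_prod_expMul_sub_smul_eq_zero ht
  obtain ⟨N', hN'⟩ := exists_prod_shiftBy_sub_smul_eq_zero ht'
  rw [dualLattice_dualLattice] at hN'
  -- The relations for all choice functions `σ` are kept, since `exists_forall_eigenvalue_eq` needs
  -- every one of them. The constant `σ` provide the polynomials for single operators.
  let B : (Fin I → Fin n) ⊕ (Fin K → Fin n) → DistOp n := Sum.elim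
    (fun σ ↦ ((List.finRange I).map fun i ↦ (expMul (ξ (σ i)) -
      algebraMap ℂ (DistOp n) (planeWave (ξ (σ i)) (q i))) ^ N).prod)
    (fun σ ↦ ((List.finRange K).map fun k ↦ (shiftBy (p (σ k)) -
      algebraMap ℂ (DistOp n) (planeWave (-p (σ k)) (η k))) ^ N').prod)
  let Q : Submodule ℂ 𝓢'(En n, ℂ) := (⊤ : Submodule ℂ 𝓢'(En n, ℂ)).annihilatedBy Finset.univ B
  let A : Fin n ⊕ Fin n → DistOp n := Sum.elim (fun j ↦ expMul (ξ j)) fun j ↦ shiftBy (p j)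
  have hA : ∀ a b, Commute (A a) (A b) := by
    rintro (a | a) (b | b)
    · exact commute_expMul _ _
    · exact h.commute_expMul_shiftBy a b
    · exact (h.commute_expMul_shiftBy b a).symm
    · exact commute_shiftBy _ _
  have hAB : ∀ a b, Commute (A a) (B b) := by
    rintro a (σ | σ)
    · refine Commute.list_prod_right _ _ fun x hx ↦ ?_
      obtain ⟨i, -, rfl⟩ := List.mem_map.1 hx
      exact (hA a (Sum.inl (σ i))).sub_algebraMap_pow _ _
    · refine Commute.list_prod_right _ _ fun x hx ↦ ?_
      obtain ⟨i, -, rfl⟩ := List.mem_map.1 hx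
      exact (hA a (Sum.inr (σ i))).sub_algebraMap_pow _ _
  have hQA : ∀ a, ∀ u ∈ Q, A a • u ∈ Q := fun a ↦
    Submodule.smul_mem_annihilatedBy (fun _ _ ↦ trivial) fun b _ ↦ hAB a b
  have hQf : ∀ a, ∃ f : Polynomial ℂ, f ≠ 0 ∧ ∀ u ∈ Q, Polynomial.aeval (A a) f • u = 0 := by
    rintro (a | a)
    · refine ⟨_, list_prod_X_sub_C_ne_zero (fun i ↦ planeWave (ξ a) (q i)) N (List.finRange I),
        fun u hu ↦ ?_⟩
      rw [aeval_list_prod_X_sub_C]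
      exact hu.2 (Sum.inl fun _ ↦ a) (Finset.mem_univ _)
    · refine ⟨_, list_prod_X_sub_C_ne_zero (fun k ↦ planeWave (-p a) (η k)) N' (List.finRange K),
        fun u hu ↦ ?_⟩
      rw [aeval_list_prod_X_sub_C]
      exact hu.2 (Sum.inr fun _ ↦ a) (Finset.mem_univ _)
  have htQ : t ∈ Q := by
    refine ⟨trivial, ?_⟩
    rintro (σ | σ) -
    · exact hN (fun i ↦ ξ (σ i)) fun i ↦ h.right_mem _
    · exact hN' (fun k ↦ p (σ k)) fun k ↦ h.left_mem _
  let W : Fin K × Fin I → Submodule ℂ 𝓢'(En n, ℂ) := fun a ↦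
    (diffOpSpan (comb L (q a.2))).map (expMul (η a.1)).toLinearMap
  have htW : t ∈ ⨆ a ∈ Finset.univ, W a := by
    refine Submodule.span_le.2 ?_ (mem_span_simultaneous hA Finset.univ hQA hQf htQ)
    rintro w ⟨hwQ, hw⟩
    by_cases hw0 : w = 0
    · rw [hw0]
      exact Submodule.zero_mem _
    choose μ m hμ using fun a ↦ hw a (Finset.mem_univ a)
    -- The modulation eigenvalues of `w` single out some `q i`, and independently the shift
    -- eigenvalues single out some `η k`; so `w` lies in `W (k, i)`.
    obtain ⟨i, hi⟩ := exists_forall_eigenvalue_eq (A := fun j ↦ (expMul (ξ j) : DistOp n))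
      (fun j k ↦ commute_expMul _ _) (c := fun i j ↦ planeWave (ξ j) (q i)) hw0
      (fun j ↦ hμ (Sum.inl j)) (List.finRange I) (fun σ ↦ hwQ.2 (Sum.inl σ) (Finset.mem_univ _))
    obtain ⟨k, hk⟩ := exists_forall_eigenvalue_eq (A := fun j ↦ (shiftBy (p j) : DistOp n))
      (fun j k ↦ commute_shiftBy _ _) (c := fun k j ↦ planeWave (-p j) (η k)) hw0
      (fun j ↦ hμ (Sum.inr j)) (List.finRange K) (fun σ ↦ hwQ.2 (Sum.inr σ) (Finset.mem_univ _))
    refine Submodule.mem_iSup_of_mem (k, i) (Submodule.mem_iSup_of_mem (Finset.mem_univ _) ?_)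
    refine ⟨expMul (-η k) • w, ?_, expMul_expMul_neg (η k) w⟩
    refine h.mem_diffOpSpan_comb (q i) (N := fun j ↦ m (Sum.inl j)) (N' := fun j ↦ m (Sum.inr j))
      (fun j ↦ ?_) fun j ↦ ?_
    · rw [← mul_smul, ← ((commute_expMul (-η k) (ξ j)).sub_algebraMap_pow _ _).eq, mul_smul, ← hi j]
      exact (congrArg _ (hμ (Sum.inl j))).trans (map_zero _)
    · rw [← mul_smul, ← (semiconjBy_expMul_neg_shiftBy (η k) (p j) _).eq, mul_smul, smul_assoc,
        ← hk j]
      have h1 : (shiftBy (p j) - algebraMap ℂ (DistOp n) (μ (Sum.inr j))) ^ m (Sum.inr j) • w = 0 :=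
        hμ (Sum.inr j)
      rw [h1]
      exact (congrArg (expMul (-η k)) (smul_zero (planeWave (η k) (p j) ^ m (Sum.inr j)))).trans
        (map_zero _)
  obtain ⟨v, hv⟩ := (Submodule.mem_iSup_finset_iff_exists_sum _ _).1 htW
  have hP : ∀ i k, ∃ P : MvPolynomial (Fin n ⊕ Fin n) ℂ,
      (v (k, i) : 𝓢'(En n, ℂ)) = expMul (η k) (polyDiffOp P (comb L (q i))) := fun i k ↦ by
    obtain ⟨y, hy, hyv⟩ := (v (k, i)).2
    obtain ⟨P, rfl⟩ := exists_polyDiffOp_eq hy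
    exact ⟨P, hyv.symm⟩
  choose P hP using hP
  refine ⟨P, ?_⟩
  rw [← hv, Fintype.sum_prod_type]
  exact Finset.sum_congr rfl fun k _ ↦ Finset.sum_congr rfl fun i _ ↦ hP i k

theorem fourier_expMul_polyDiffOp_comb [DiscreteTopology L] [IsZLattice ℝ L] (η q : En n)
    (P : MvPolynomial (Fin n ⊕ Fin n) ℂ) :
    (𝓕 (expMul η (polyDiffOp P (comb L q))) : 𝓢'(En n, ℂ)) =
      (((ZLattice.covolume L)⁻¹ : ℝ) : ℂ) •
        shiftBy η (fourierPolyDiffOp P (expMul (-q) (comb (dualLattice L) 0))) := by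
  rw [fourier_expMul, fourier_polyDiffOp, fourier_comb, map_smul, map_smul]

theorem fourier_sum {ι : Type*} (s : Finset ι) (u : ι → 𝓢'(En n, ℂ)) :
    (𝓕 (∑ i ∈ s, u i) : 𝓢'(En n, ℂ)) = ∑ i ∈ s, (𝓕 (u i) : 𝓢'(En n, ℂ)) :=
  map_sum (FourierTransform.fourierCLM ℂ 𝓢'(En n, ℂ)) u s

end poissonForm

/-! ### The main theorem. -/

theorem theorem3 {n I K : ℕ}
    (L Γ : Submodule ℤ (En n)) [DiscreteTopology L] [IsZLattice ℝ L]
    [DiscreteTopology Γ] [IsZLattice ℝ Γ]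
    (q : Fin I → En n) (η : Fin K → En n) (t : 𝓢'(En n, ℂ))
    (ht : Distribution.dsupport t ⊆ crystal L q)
    (ht' : Distribution.dsupport (𝓕 t : 𝓢'(En n, ℂ)) ⊆ crystal Γ η) :
    (t ≠ 0 →
      AddSubgroup.Commensurable Γ.toAddSubgroup (dualLattice L).toAddSubgroup ∧
      ∃ (K' : ℕ) (η' : Fin K' → En n), (∀ k, η' k ∈ crystal Γ η) ∧
        crystal Γ η ⊆ crystal (dualLattice L) η') ∧
    ∀ (K' : ℕ) (η' : Fin K' → En n),
      Distribution.dsupport (𝓕 t : 𝓢'(En n, ℂ)) ⊆ crystal (dualLattice L) η' →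
      ∃ P : Fin I → Fin K' → MvPolynomial (Fin n ⊕ Fin n) ℂ,
        t = ∑ k, ∑ i, expMul (η' k) (polyDiffOp (P i k) (comb L (q i))) ∧
        𝓕 t = ∑ k, ∑ i, (((ZLattice.covolume L)⁻¹ : ℝ) : ℂ) •
          shiftBy (η' k) (fourierPolyDiffOp (P i k) (expMul (-(q i)) (comb (dualLattice L) 0))) := by
  refine ⟨fun ht0 ↦ ?_, fun K' η' hη' ↦ ?_⟩
  · have h := commensurable_dualLattice (L := L) (Γ := Γ) fun x hx γ hγ ↦
      exists_nat_mul_inner_eq_int ht ht' ht0 hx hγ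
    -- The second half of commensurability is the finite index of the intersection in `Γ`.
    exact ⟨h, exists_crystal_subset h.2 η⟩
  · obtain ⟨P, hP⟩ := exists_eq_sum_expMul_polyDiffOp_comb ht hη'
    refine ⟨P, hP, ?_⟩
    conv_lhs => rw [hP]
    simp only [fourier_sum, fourier_expMul_polyDiffOp_comb]
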